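/- **Setting.** Fix $\eta\in\mathbb R$. In round $t=1,2,\dots$ the exponentially weighted forecaster on $[0,1)$ first (sampling step) draws $x_t$ from the density $$p_t(x)=\frac{\exp(\eta F_t(x))}{\int_0^1\exp(\eta F_t(y))\,dy},\qquad F_t=\sum_{s<t}f_s ,$$ and then (update step) receives a piecewise constant $f_t:[0,1)\to[0,1]$ with $k$ pieces, given by break points $0=a_{t,0}\le a_{t,1}\le\dots\le a_{t,k}=1$ and values $v_{t,j}\in[0,1]$ on $[a_{t,j-1},a_{t,j})$, and sets $F_{t+1}=F_t+f_t$. **Data structure.** The forecaster is implemented with a red-black binary tree. Each node $N$ stores an interval $I(N)=[a,b)$, a weight $w(N)$ and a message $m(N)$; each internal node has a left child $l(N)$ and a right child $h(N)$. Initially there is one node, with $I=[0,1)$, $w=1$, $m=1$. The operations are the following. * $\mathsf{UpdateMessage}(N)$: multiply $w(N)$ by $m(N)$, multiply the messages of the children of $N$ by $m(N)$, set $m(N)=1$; then do the same at $l(N)$ and at $h(N)$. * $\mathsf{Draw}$: take independent uniform $x,u\in[0,1)$, apply $\mathsf{UpdateMessage}$ to the root $r$ and put $\hat x=x\,w(r)$.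 At an internal node $N$, apply $\mathsf{UpdateMessage}$ to $l(N)$ and $h(N)$; if $\hat x<w(l(N))$ go to $l(N)$, otherwise replace $\hat x$ by $\hat x-w(l(N))$ and go to $h(N)$. At a leaf with interval $[a,b)$ return $a+u(b-a)$. * $\mathsf{Insert}([a,b))$: for $p=a$ and then $p=b$, if $p$ lies in the interior of the interval of a leaf, split that leaf at $p$, dividing its weight in proportion to length, by red-black insertion. $\mathsf{UpdateMessage}$ is applied top-down along the search path, and $w(N)=w(l(N))+w(h(N))$, $I(N)=I(l(N))\cup I(h(N))$ are recomputed bottom-up. * $\mathsf{Update}([a,b),q)$: perform $\mathsf{Insert}([a,b))$. Apply $\mathsf{UpdateMessage}$ top-down along the paths from the root to the leaf whose interval starts at $a$ and to the leaf whose interval ends at $b$. Multiply the weights of these leaves by $q$ (once, if they coincide). Give the message $q$ to every child that hangs off these two paths, below their lowest common ancestor, on the side inside $[a,b)$. Recompute the weights on the paths bottom-up, counting each child with new message $q$ as $q$ times its stored weight. The sampling step is a call of $\mathsf{Draw}$. The update step calls $\mathsf{Update}([a_{t,j-1},a_{t,j}),e^{\eta v_{t,j}})$ for $j=1,\dots,k$,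 skipping empty pieces. Time is counted on a real-number pointer machine with unit cost for each arithmetic operation, exponential, comparison, record access or creation, and uniform random number. **Theorem.** Let $k$, $\eta$ and $f_1,f_2,\dots$ be as above, and consider any realization of the random numbers used in the earlier rounds. 1. At the beginning of every round $t$ the tree is an interval tree on $[0,1)$: the root has interval $[0,1)$, all intervals are nonempty, and the interval of each internal node is the disjoint union of those of its children, left before right. With $\omega_t(N)=w(N)\,m(N)\prod_{N'\text{ proper ancestor of }N}m(N')$ one has $$\omega_t(N)=\sum_{\ell\text{ leaf below }N}\omega_t(\ell)\ \text{ for every node }N\qquad\text{and}\qquad \omega_t(\ell)=|I(\ell)|\exp(\eta F_t(x))\ \text{ for every leaf }\ell\text{ and every }x\in I(\ell),$$ where a leaf counts as the only leaf below itself. 2. The point returned by $\mathsf{Draw}$ in round $t$ (with fresh random numbers) has exactly the density $p_t$ on $[0,1)$. 3. There is an absolute constant $C$ such that, for all $T,k$ with $Tk\ge 2$, in each of the rounds $t=1,\dots,T$ the sampling step takes at most $C\log(Tk)$ time and the update step takes at most $C\,k\log(Tk)$ time, whatever $\eta$, the $f_s$ and the random numbers are. That is, these steps take $O(\log(Tk))$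 and $O(k\log(Tk))$ time. -/

import Mathlib

open MeasureTheory Set

noncomputable section

namespace LazyTree

/-! ### Step counting

Unit-cost real-number pointer machine: one step per arithmetic operation, exponential,
comparison, field access, record inspection, record allocation, or random number. -/

/-- A computation returning `val` after `steps` elementary operations. -/
structure Timed (α : Type) where
  val : α
  steps : ℕ

instance : Monad Timed where
  pure a := ⟨a, 0⟩
  bind x f := ⟨(f x.val).val, x.steps + (f x.val).steps⟩

/-- One elementary operation with result `a`. -/
def op {α : Type} (a : α) : Timed α := ⟨a, 1⟩

/-- `n` elementary operations (used to pay for calls and for inspecting records). -/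
def tick (n : ℕ) : Timed Unit := ⟨(), n⟩

/-- The same computation, whose result remembers where it comes from. It is used only to
justify that the recursions below terminate. -/
def Timed.attach {α : Type} (x : Timed α) : Timed {a : α // a = x.val} :=
  ⟨⟨x.val, rfl⟩, x.steps⟩

/-! ### The augmented interval tree -/

/-- Colours of a red-black tree. -/
inductive Color where
  | red
  | black

/-- A node `N` stores its interval `I(N) = [lo, hi)`, its weight `w(N)` and its message `m(N)`;
an internal node also has a colour and two children `l(N)`, `h(N)`. -/
inductive ITree where
  | leaf (lo hi w m : ℝ) : ITree
  | node (c : Color) (lo hi w m : ℝ) (l h : ITree) : ITree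

namespace ITree

def lo : ITree → ℝ
  | leaf lo _ _ _ => lo
  | node _ lo _ _ _ _ _ => lo

def hi : ITree → ℝ
  | leaf _ hi _ _ => hi
  | node _ _ hi _ _ _ _ => hi

def weight : ITree → ℝ
  | leaf _ _ w _ => w
  | node _ _ _ w _ _ _ => w

def msg : ITree → ℝ
  | leaf _ _ _ m => m
  | node _ _ _ _ m _ _ => m

def isLeaf : ITree → Bool
  | leaf _ _ _ _ => true
  | node _ _ _ _ _ _ _ => false

/-- The number of nodes. -/
def size : ITree → ℕ
  | leaf _ _ _ _ => 1
  | node _ _ _ _ _ l h => l.size + h.size + 1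

/-- The intervals are nonempty, and the interval of an internal node is the disjoint union of
those of its children, `I(l(N))` lying to the left of `I(h(N))`. -/
def IsIntervalTree : ITree → Prop
  | leaf lo hi _ _ => lo < hi
  | node _ lo hi _ _ l h =>
      l.lo = lo ∧ l.hi = h.lo ∧ h.hi = hi ∧ l.IsIntervalTree ∧ h.IsIntervalTree

/-- All nodes `N` of a tree, each paired with the product of the messages of its proper
ancestors, where `c` is the product of the messages above the root. -/
def nodes (c : ℝ) : ITree → List (ℝ × ITree)
  | leaf lo hi w m => [(c, leaf lo hi w m)]
  | node col lo hi w m l h =>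
      (c, node col lo hi w m l h) :: (nodes (c * m) l ++ nodes (c * m) h)

/-- `ω(N) = w(N) · m(N) · ∏ m(N')`, the product over the proper ancestors `N'` of `N`. -/
def omega (N : ℝ × ITree) : ℝ := N.2.weight * N.2.msg * N.1

/-- The leaf descendants of `N`, again with the products of their ancestors' messages. -/
def leavesBelow (N : ℝ × ITree) : List (ℝ × ITree) :=
  (nodes N.1 N.2).filter (fun L => L.2.isLeaf)

end ITree

open ITree Color

/-! ### Messages -/

/-- `m(N) ← m(N) · q`. -/
def mulMsg (q : ℝ) : ITree → Timed ITree
  | leaf lo hi w m => do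
      tick 1
      let m' ← op (m * q)
      op (leaf lo hi w m')
  | node c lo hi w m l h => do
      tick 1
      let m' ← op (m * q)
      op (node c lo hi w m' l h)

/-- `m(N) ← q`. -/
def setMsg (q : ℝ) : ITree → Timed ITree
  | leaf lo hi w _ => do
      tick 1
      op (leaf lo hi w q)
  | node c lo hi w _ l h => do
      tick 1
      op (node c lo hi w q l h)

/-- Apply the message of `N` to its weight and pass it on to the children of `N`. -/
def settle : ITree → Timed ITree
  | leaf lo hi w m => do
      tick 1
      let w' ← op (w * m)
      op (leaf lo hi w' 1)
  | node c lo hi w m l h => do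
      tick 1
      let w' ← op (w * m)
      let l' ← mulMsg m l
      let h' ← mulMsg m h
      op (node c lo hi w' 1 l' h')

/-- `UpdateMessage(N)`: make `N`, `l(N)` and `h(N)` up-to-date, propagating their messages to
the children of `l(N)` and `h(N)`. -/
def updateMessage (t : ITree) : Timed ITree := do
  let t' ← settle t
  tick 1
  match t' with
  | leaf lo hi w m => return leaf lo hi w m
  | node c lo hi w m l h => do
      let l' ← settle l
      let h' ← settle h
      op (node c lo hi w m l' h')

theorem size_mulMsg (q : ℝ) (t : ITree) : (mulMsg q t).val.size = t.size := by
  cases t <;> rfl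

theorem size_settle (t : ITree) : (settle t).val.size = t.size := by
  cases t with
  | leaf lo hi w m => rfl
  | node c lo hi w m l h =>
      change (mulMsg m l).val.size + (mulMsg m h).val.size + 1 = l.size + h.size + 1
      rw [size_mulMsg, size_mulMsg]

theorem size_updateMessage (t : ITree) : (updateMessage t).val.size = t.size := by
  rw [← size_settle t]
  change (Timed.val (match (settle t).val with
    | leaf lo hi w m => (pure (leaf lo hi w m) : Timed ITree)
    | node c lo hi w m l h => do
        let l' ← settle l
        let h' ← settle h
        op (node c lo hi w m l' h'))).size = _
  cases (settle t).val with
  | leaf lo hi w m => rfl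
  | node c lo hi w m l h =>
      change (settle l).val.size + (settle h).val.size + 1 = l.size + h.size + 1
      rw [size_settle, size_settle]

/-! ### Draw -/

/-- The descent of `Draw` from an up-to-date node; `x` is the position looked for inside the
total weight of the node and `u` selects the point of the leaf interval that is reached. -/
def descend (t : ITree) (x u : ℝ) : Timed (ITree × ℝ) :=
  match t with
  | leaf lo hi w m => do
      tick 1
      let d ← op (hi - lo)
      let s ← op (u * d)
      let p ← op (lo + s)
      return (leaf lo hi w m, p)
  | node c lo hi w m l h => do
      tick 1
      let ⟨l₁, _hl⟩ ← (updateMessage l).attach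
      let ⟨h₁, _hh⟩ ← (updateMessage h).attach
      let wl ← op l₁.weight
      let goLeft ← op (decide (x < wl))
      if goLeft then
        let (l₂, p) ← descend l₁ x u
        let t' ← op (node c lo hi w m l₂ h₁)
        return (t', p)
      else
        let x' ← op (x - wl)
        let (h₂, p) ← descend h₁ x' u
        let t' ← op (node c lo hi w m l₁ h₂)
        return (t', p)
termination_by t.size
decreasing_by
  · subst _hl
    rw [size_updateMessage]
    simp only [ITree.size]
    omega
  · subst _hh
    rw [size_updateMessage]
    simp only [ITree.size]
    omega

/-- `Draw`, with its two independent uniform random numbers `seed` in `[0,1)`: the first selects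
a leaf, the second a point of the interval of that leaf. Returns the tree after the call and the
point. -/
def draw (t : ITree) (seed : ℝ × ℝ) : Timed (ITree × ℝ) := do
  let x ← op seed.1
  let u ← op seed.2
  let t' ← updateMessage t
  let w ← op t'.weight
  let x' ← op (x * w)
  descend t' x' u

/-! ### Insert -/

/-- A node with children `l`, `h`: `I ← I(l) ∪ I(h)`, `w ← w(l) + w(h)`, message `1`. -/
def mkNode (c : Color) (l h : ITree) : Timed ITree := do
  let a ← op l.lo
  let b ← op h.hi
  let wl ← op l.weight
  let wh ← op h.weight
  let w ← op (wl + wh)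
  op (node c a b w 1 l h)

/-- Rebuild a node after an insertion into its left child, with a red-black rotation if the
left child is red and has a red child. -/
def balanceLeft : Color → ITree → ITree → Timed ITree
  | black, node red _ _ _ _ (node red _ _ _ _ t₁ t₂) t₃, t₄ => do
      tick 3
      let l ← mkNode black t₁ t₂
      let h ← mkNode black t₃ t₄
      mkNode red l h
  | black, node red _ _ _ _ t₁ (node red _ _ _ _ t₂ t₃), t₄ => do
      tick 3
      let l ← mkNode black t₁ t₂
      let h ← mkNode black t₃ t₄
      mkNode red l h
  | c, l, h => do
      tick 3
      mkNode c l h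

/-- Mirror image of `balanceLeft`. -/
def balanceRight : Color → ITree → ITree → Timed ITree
  | black, t₁, node red _ _ _ _ (node red _ _ _ _ t₂ t₃) t₄ => do
      tick 3
      let l ← mkNode black t₁ t₂
      let h ← mkNode black t₃ t₄
      mkNode red l h
  | black, t₁, node red _ _ _ _ t₂ (node red _ _ _ _ t₃ t₄) => do
      tick 3
      let l ← mkNode black t₁ t₂
      let h ← mkNode black t₃ t₄
      mkNode red l h
  | c, l, h => do
      tick 3
      mkNode c l h

/-- Red-black insertion of the breakpoint `p`: the leaf whose interval contains `p` is split at
`p`, unless its interval starts at `p`; `UpdateMessage` is applied top-down on the way. -/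
def splitAt (p : ℝ) (t : ITree) : Timed ITree := do
  let ⟨t₁, ht⟩ ← (updateMessage t).attach
  tick 1
  match t₁, ht with
  | leaf lo hi w m, _ => do
      let b₁ ← op (decide (lo < p))
      let b₂ ← op (decide (p < hi))
      if b₁ && b₂ then
        let len ← op (hi - lo)
        let d₁ ← op (p - lo)
        let q₁ ← op (d₁ * w)
        let w₁ ← op (q₁ / len)
        let d₂ ← op (hi - p)
        let q₂ ← op (d₂ * w)
        let w₂ ← op (q₂ / len)
        let l ← op (leaf lo p w₁ 1)
        let h ← op (leaf p hi w₂ 1)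
        mkNode red l h
      else
        return leaf lo hi w m
  | node c _ _ _ _ l h, _ht => do
      let s ← op h.lo
      let goLeft ← op (decide (p < s))
      if goLeft then
        let l' ← splitAt p l
        balanceLeft c l' h
      else
        let h' ← splitAt p h
        balanceRight c l h'
termination_by t.size
decreasing_by
  all_goals
    have hs := congrArg ITree.size _ht
    rw [size_updateMessage] at hs
    simp only [ITree.size] at hs
    omega

/-- Colour the root black. -/
def blacken : ITree → Timed ITree
  | leaf lo hi w m => do
      tick 1
      return leaf lo hi w m
  | node _ lo hi w m l h => do
      tick 1
      op (node black lo hi w m l h)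

/-- `Insert([a, b))`. -/
def insertInterval (a b : ℝ) (t : ITree) : Timed ITree := do
  let t₁ ← splitAt a t
  let t₂ ← blacken t₁
  let t₃ ← splitAt b t₂
  blacken t₃

/-! ### Update -/

/-- Multiply the weights to the right of `a` by `q`, along the path to the leaf whose interval
starts at `a`. -/
def updateFrom (a q : ℝ) (t : ITree) : Timed ITree := do
  let ⟨t₁, ht⟩ ← (updateMessage t).attach
  tick 1
  match t₁, ht with
  | leaf lo hi w m, _ => do
      let w' ← op (w * q)
      op (leaf lo hi w' m)
  | node c lo hi _ m l h, _ht => do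
      let s ← op h.lo
      let goLeft ← op (decide (a < s))
      if goLeft then
        let l' ← updateFrom a q l
        let wl ← op l'.weight
        let wh ← op h.weight
        let r ← op (q * wh)
        let w' ← op (wl + r)
        let h' ← setMsg q h
        op (node c lo hi w' m l' h')
      else
        let h' ← updateFrom a q h
        let wl ← op l.weight
        let wh ← op h'.weight
        let w' ← op (wl + wh)
        op (node c lo hi w' m l h')
termination_by t.size
decreasing_by
  all_goals
    have hs := congrArg ITree.size _ht
    rw [size_updateMessage] at hs
    simp only [ITree.size] at hs
    omega

/-- Multiply the weights to the left of `b` by `q`, along the path to the leaf whose interval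
ends at `b`. -/
def updateUpTo (b q : ℝ) (t : ITree) : Timed ITree := do
  let ⟨t₁, ht⟩ ← (updateMessage t).attach
  tick 1
  match t₁, ht with
  | leaf lo hi w m, _ => do
      let w' ← op (w * q)
      op (leaf lo hi w' m)
  | node c lo hi _ m l h, _ht => do
      let s ← op h.lo
      let goLeft ← op (decide (b ≤ s))
      if goLeft then
        let l' ← updateUpTo b q l
        let wl ← op l'.weight
        let wh ← op h.weight
        let w' ← op (wl + wh)
        op (node c lo hi w' m l' h)
      else
        let h' ← updateUpTo b q h
        let wl ← op l.weight
        let wh ← op h'.weight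
        let r ← op (q * wl)
        let w' ← op (r + wh)
        let l' ← setMsg q l
        op (node c lo hi w' m l' h')
termination_by t.size
decreasing_by
  all_goals
    have hs := congrArg ITree.size _ht
    rw [size_updateMessage] at hs
    simp only [ITree.size] at hs
    omega

/-- Multiply the weights in `[a, b)` by `q`, when `a` and `b` are end points of leaf intervals:
descend to the lowest common ancestor of the leaf starting at `a` and the leaf ending at `b`,
treat the two paths below it, and recompute the weights on the way back to the root. -/
def updateBetween (a b q : ℝ) (t : ITree) : Timed ITree := do
  let ⟨t₁, ht⟩ ← (updateMessage t).attach
  tick 1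
  match t₁, ht with
  | leaf lo hi w m, _ => do
      let w' ← op (w * q)
      op (leaf lo hi w' m)
  | node c _ _ _ _ l h, _ht => do
      let s ← op h.lo
      let allLeft ← op (decide (b ≤ s))
      let allRight ← op (decide (s ≤ a))
      if allLeft then
        let l' ← updateBetween a b q l
        mkNode c l' h
      else if allRight then
        let h' ← updateBetween a b q h
        mkNode c l h'
      else
        let l' ← updateFrom a q l
        let h' ← updateUpTo b q h
        mkNode c l' h'
termination_by t.size
decreasing_by
  all_goals
    have hs := congrArg ITree.size _ht
    rw [size_updateMessage] at hs
    simp only [ITree.size] at hs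
    omega

/-- `Update([a, b), q)`. -/
def update (a b q : ℝ) (t : ITree) : Timed ITree := do
  let t' ← insertInterval a b t
  updateBetween a b q t'

/-! ### The forecaster -/

/-- The data of a piecewise constant function `[0,1) → [0,1]` with `k` pieces: break points
`0 = a 0 ≤ a 1 ≤ ⋯ ≤ a k = 1`, and the value `v i` on the piece `[a i, a (i+1))`. -/
structure StepFun (k : ℕ) where
  a : Fin (k + 1) → ℝ
  v : Fin k → ℝ
  mono : Monotone a
  a_zero : a 0 = 0
  a_last : a (Fin.last k) = 1
  v_mem : ∀ i, v i ∈ Icc (0 : ℝ) 1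

/-- The function itself (extended by `0` outside `[0,1)`). -/
def StepFun.eval {k : ℕ} (f : StepFun k) (x : ℝ) : ℝ :=
  ∑ i : Fin k, (Ico (f.a i.castSucc) (f.a i.succ)).indicator (fun _ => f.v i) x

/-- The cumulative payoff of the first `t` functions. -/
def cumulative {k : ℕ} (f : ℕ → StepFun k) (t : ℕ) (x : ℝ) : ℝ :=
  ∑ s ∈ Finset.range t, (f s).eval x

/-- The distribution on `[0,1)` with density `exp (η F(x)) / ∫₀¹ exp (η F)`. -/
def gibbs (η : ℝ) (F : ℝ → ℝ) : Measure ℝ :=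
  (volume.restrict (Ico (0 : ℝ) 1)).withDensity fun x =>
    ENNReal.ofReal (Real.exp (η * F x) / ∫ y in (0 : ℝ)..1, Real.exp (η * F y))

/-- The law of the two independent uniform random numbers that `draw` uses. -/
def seedLaw : Measure (ℝ × ℝ) :=
  (volume.restrict (Ico (0 : ℝ) 1)).prod (volume.restrict (Ico (0 : ℝ) 1))

/-- The update step: `Update([a_{j-1}, a_j), exp (η v_j))` for each (nonempty) piece in turn. -/
def updateStep (η : ℝ) {k : ℕ} (f : StepFun k) (t : ITree) : Timed ITree :=
  (List.finRange k).foldlM (init := t) fun t j => do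
    tick 1
    let a ← op (f.a j.castSucc)
    let b ← op (f.a j.succ)
    let nonempty ← op (decide (a < b))
    if nonempty then
      let v ← op (f.v j)
      let e ← op (η * v)
      let q ← op (Real.exp e)
      update a b q t
    else
      return t

/-- The tree after `t` rounds, i.e. at the beginning of round `t + 1`, when the functions are
`f 0, f 1, …` and the random numbers used in the successive rounds are `seed 0, seed 1, …`. -/
def treeAfter (η : ℝ) {k : ℕ} (f : ℕ → StepFun k) (seed : ℕ → ℝ × ℝ) : ℕ → ITree
  | 0 => leaf 0 1 1 1
  | t + 1 => (updateStep η (f t) (draw (treeAfter η f seed t) (seed t)).val.1).val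

end LazyTree

end

open LazyTree

/-!
The forecaster's tree is followed through three independent invariants.

*Weights.* `ITree.Represents S g c t` says that `t` encodes the piecewise constant density `g`: the
intervals fit together, each internal weight is the sum of the weights of the children after their
own messages, and the weight of a leaf, multiplied by all messages on its path, is the length of
its interval times the value of `g` there. A pending message is the same thing as a scaling of the
density (`ITree.Represents.scale`, `represents_mulMsg`), so `UpdateMessage` and `Draw` keep `g`,
and `Update([a, b), q)` multiplies `g` by `q` on `[a, b)` (`represents_update`). Hence after `t`
rounds the tree represents `exp (η F)`. The set `S` holds points that are not interior to a leaf;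
it records that the end points of `[a, b)` have been inserted.

*Balance.* Insertion keeps the red-black property (`isRedBlack_splitAt`), the other operations do
not change the shape (`skeleton_draw`, `skeleton_updateBetween`), and each insertion adds at most
one leaf. So the depth is logarithmic in the number of leaves, which is at most `1 + 2Tk`, and each
operation costs a constant number of steps per level. The red-black property also matters for the
weights: a rotation recomputes weights from stored ones, ignoring messages, and it is the absence of
red-red pairs away from the insertion path that ensures that only nodes whose messages have been
passed on are moved (`ITree.IsRotatable`, `represents_splitAt`).

*Sampling.* By induction along the descent, a uniform position in the weight of a node is carried to
a point with density `g` on the interval of the node (`map_descend`): the positions below the weight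
of the left child, and the remaining ones after a translation, are uniform in the weights of the two
children. Normalising by the root weight, which is `∫ g`, gives the Gibbs density (`map_draw`).
-/

namespace LazyTree
open ITree Color

/-! ### Timed computations -/

@[simp] theorem bind_val {α β : Type} (x : Timed α) (f : α → Timed β) :
    (x >>= f).val = (f x.val).val := rfl

@[simp] theorem bind_steps {α β : Type} (x : Timed α) (f : α → Timed β) :
    (x >>= f).steps = x.steps + (f x.val).steps := rfl

@[simp] theorem pure_val {α : Type} (a : α) : (pure a : Timed α).val = a := rfl

@[simp] theorem pure_steps {α : Type} (a : α) : (pure a : Timed α).steps = 0 := rfl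

@[simp] theorem op_val {α : Type} (a : α) : (op a).val = a := rfl

@[simp] theorem op_steps {α : Type} (a : α) : (op a).steps = 1 := rfl

@[simp] theorem tick_steps (n : ℕ) : (tick n).steps = n := rfl

@[simp] theorem attach_val {α : Type} (x : Timed α) : (x.attach.val : α) = x.val := rfl

@[simp] theorem attach_steps {α : Type} (x : Timed α) : x.attach.steps = x.steps := rfl

/-! ### The primitive operations -/

@[simp] theorem mulMsg_leaf_val (q lo hi w m : ℝ) :
    (mulMsg q (leaf lo hi w m)).val = leaf lo hi w (m * q) := rfl

@[simp] theorem mulMsg_node_val (q : ℝ) (c : Color) (lo hi w m : ℝ) (l h : ITree) :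
    (mulMsg q (node c lo hi w m l h)).val = node c lo hi w (m * q) l h := rfl

@[simp] theorem setMsg_leaf_val (q lo hi w m : ℝ) :
    (setMsg q (leaf lo hi w m)).val = leaf lo hi w q := rfl

@[simp] theorem setMsg_node_val (q : ℝ) (c : Color) (lo hi w m : ℝ) (l h : ITree) :
    (setMsg q (node c lo hi w m l h)).val = node c lo hi w q l h := rfl

@[simp] theorem settle_leaf_val (lo hi w m : ℝ) :
    (settle (leaf lo hi w m)).val = leaf lo hi (w * m) 1 := rfl

@[simp] theorem settle_node_val (c : Color) (lo hi w m : ℝ) (l h : ITree) :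
    (settle (node c lo hi w m l h)).val =
      node c lo hi (w * m) 1 (mulMsg m l).val (mulMsg m h).val := rfl

@[simp] theorem updateMessage_leaf_val (lo hi w m : ℝ) :
    (updateMessage (leaf lo hi w m)).val = leaf lo hi (w * m) 1 := rfl

@[simp] theorem updateMessage_node_val (c : Color) (lo hi w m : ℝ) (l h : ITree) :
    (updateMessage (node c lo hi w m l h)).val =
      node c lo hi (w * m) 1 (settle (mulMsg m l).val).val (settle (mulMsg m h).val).val := rfl

@[simp] theorem mkNode_val (c : Color) (l h : ITree) :
    (mkNode c l h).val = node c l.lo h.hi (l.weight + h.weight) 1 l h := rfl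

@[simp] theorem mkNode_steps (c : Color) (l h : ITree) : (mkNode c l h).steps = 6 := rfl

@[simp] theorem setMsg_steps (q : ℝ) (t : ITree) : (setMsg q t).steps = 2 := by cases t <;> rfl

theorem mulMsg_steps (q : ℝ) (t : ITree) : (mulMsg q t).steps = 3 := by cases t <;> rfl

theorem settle_steps_le (t : ITree) : (settle t).steps ≤ 9 := by
  cases t <;> simp [settle, mulMsg_steps]

theorem updateMessage_steps_le (t : ITree) : (updateMessage t).steps ≤ 29 := by
  unfold updateMessage
  have h := settle_steps_le t
  simp only [bind_steps, tick_steps]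
  split
  · simp only [pure_steps]; omega
  · rename_i l r _
    have hl := settle_steps_le l
    have hr := settle_steps_le r
    simp only [bind_steps, op_steps]
    omega

theorem balanceLeft_steps_le (c : Color) (l h : ITree) : (balanceLeft c l h).steps ≤ 21 := by
  unfold balanceLeft; split <;> simp

theorem balanceRight_steps_le (c : Color) (l h : ITree) : (balanceRight c l h).steps ≤ 21 := by
  unfold balanceRight; split <;> simp

theorem blacken_steps_le (t : ITree) : (blacken t).steps ≤ 2 := by
  cases t <;> simp [blacken]

/-! ### Unfolding the recursive operations -/

theorem splitAt_val_of_leaf {t : ITree} {lo hi w m : ℝ} (p : ℝ)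
    (ht : (updateMessage t).val = leaf lo hi w m) :
    (splitAt p t).val = if lo < p ∧ p < hi then
        node red lo hi ((p - lo) * w / (hi - lo) + (hi - p) * w / (hi - lo)) 1
          (leaf lo p ((p - lo) * w / (hi - lo)) 1) (leaf p hi ((hi - p) * w / (hi - lo)) 1)
      else leaf lo hi w m := by
  rw [splitAt]
  simp only [bind_val]
  split
  · rename_i heq _
    cases ht.symm.trans heq
    by_cases hp : lo < p ∧ p < hi <;> simp [hp, ITree.lo, ITree.hi, ITree.weight]
  · rename_i heq _
    cases ht.symm.trans heq

theorem splitAt_val_of_node {t : ITree} {c : Color} {lo hi w m : ℝ} {l h : ITree} (p : ℝ)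
    (ht : (updateMessage t).val = node c lo hi w m l h) :
    (splitAt p t).val = if p < h.lo then (balanceLeft c (splitAt p l).val h).val
      else (balanceRight c l (splitAt p h).val).val := by
  rw [splitAt]
  simp only [bind_val]
  split
  · rename_i heq _
    cases ht.symm.trans heq
  · rename_i heq _
    cases ht.symm.trans heq
    by_cases hp : p < h.lo <;> simp [hp]

theorem splitAt_steps_of_leaf {t : ITree} {lo hi w m : ℝ} (p : ℝ)
    (ht : (updateMessage t).val = leaf lo hi w m) :
    (splitAt p t).steps ≤ (updateMessage t).steps + 18 := by
  rw [splitAt]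
  simp only [bind_steps]
  split
  · rename_i heq _
    cases ht.symm.trans heq
    by_cases hp : lo < p ∧ p < hi <;> simp [hp]
  · rename_i heq _
    cases ht.symm.trans heq

theorem splitAt_steps_of_node {t : ITree} {c : Color} {lo hi w m : ℝ} {l h : ITree} (p : ℝ)
    (ht : (updateMessage t).val = node c lo hi w m l h) :
    (splitAt p t).steps ≤ (updateMessage t).steps + 24 +
      max (splitAt p l).steps (splitAt p h).steps := by
  rw [splitAt]
  simp only [bind_steps]
  split
  · rename_i heq _
    cases ht.symm.trans heq
  · rename_i heq _
    cases ht.symm.trans heq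
    have h₁ := balanceLeft_steps_le c (splitAt p l).val h
    have h₂ := balanceRight_steps_le c l (splitAt p h).val
    by_cases hp : p < h.lo <;> simp [hp] <;> omega

theorem updateFrom_val_of_leaf {t : ITree} {lo hi w m : ℝ} (a q : ℝ)
    (ht : (updateMessage t).val = leaf lo hi w m) :
    (updateFrom a q t).val = leaf lo hi (w * q) m := by
  rw [updateFrom]
  simp only [bind_val]
  split <;> rename_i heq _ <;> cases ht.symm.trans heq
  simp

theorem updateFrom_val_of_node {t : ITree} {c : Color} {lo hi w m : ℝ} {l h : ITree} (a q : ℝ)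
    (ht : (updateMessage t).val = node c lo hi w m l h) :
    (updateFrom a q t).val = if a < h.lo then
        node c lo hi ((updateFrom a q l).val.weight + q * h.weight) m
          (updateFrom a q l).val (setMsg q h).val
      else
        node c lo hi (l.weight + (updateFrom a q h).val.weight) m l (updateFrom a q h).val := by
  rw [updateFrom]
  simp only [bind_val]
  split <;> rename_i heq _ <;> cases ht.symm.trans heq
  by_cases hp : a < h.lo <;> simp [hp]

theorem updateFrom_steps_of_leaf {t : ITree} {lo hi w m : ℝ} (a q : ℝ)
    (ht : (updateMessage t).val = leaf lo hi w m) :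
    (updateFrom a q t).steps = (updateMessage t).steps + 3 := by
  rw [updateFrom]
  simp only [bind_steps]
  split <;> rename_i heq _ <;> cases ht.symm.trans heq
  simp

theorem updateFrom_steps_of_node {t : ITree} {c : Color} {lo hi w m : ℝ} {l h : ITree}
    (a q : ℝ) (ht : (updateMessage t).val = node c lo hi w m l h) :
    (updateFrom a q t).steps ≤ (updateMessage t).steps + 10 +
      max (updateFrom a q l).steps (updateFrom a q h).steps := by
  rw [updateFrom]
  simp only [bind_steps]
  split <;> rename_i heq _ <;> cases ht.symm.trans heq
  by_cases hp : a < h.lo <;> simp [hp] <;> omega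

theorem updateUpTo_val_of_leaf {t : ITree} {lo hi w m : ℝ} (b q : ℝ)
    (ht : (updateMessage t).val = leaf lo hi w m) :
    (updateUpTo b q t).val = leaf lo hi (w * q) m := by
  rw [updateUpTo]
  simp only [bind_val]
  split <;> rename_i heq _ <;> cases ht.symm.trans heq
  simp

theorem updateUpTo_val_of_node {t : ITree} {c : Color} {lo hi w m : ℝ} {l h : ITree} (b q : ℝ)
    (ht : (updateMessage t).val = node c lo hi w m l h) :
    (updateUpTo b q t).val = if b ≤ h.lo then
        node c lo hi ((updateUpTo b q l).val.weight + h.weight) m (updateUpTo b q l).val h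
      else
        node c lo hi (q * l.weight + (updateUpTo b q h).val.weight) m
          (setMsg q l).val (updateUpTo b q h).val := by
  rw [updateUpTo]
  simp only [bind_val]
  split <;> rename_i heq _ <;> cases ht.symm.trans heq
  by_cases hp : b ≤ h.lo <;> simp [hp]

theorem updateUpTo_steps_of_leaf {t : ITree} {lo hi w m : ℝ} (b q : ℝ)
    (ht : (updateMessage t).val = leaf lo hi w m) :
    (updateUpTo b q t).steps = (updateMessage t).steps + 3 := by
  rw [updateUpTo]
  simp only [bind_steps]
  split <;> rename_i heq _ <;> cases ht.symm.trans heq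
  simp

theorem updateUpTo_steps_of_node {t : ITree} {c : Color} {lo hi w m : ℝ} {l h : ITree}
    (b q : ℝ) (ht : (updateMessage t).val = node c lo hi w m l h) :
    (updateUpTo b q t).steps ≤ (updateMessage t).steps + 10 +
      max (updateUpTo b q l).steps (updateUpTo b q h).steps := by
  rw [updateUpTo]
  simp only [bind_steps]
  split <;> rename_i heq _ <;> cases ht.symm.trans heq
  by_cases hp : b ≤ h.lo <;> simp [hp] <;> omega

theorem updateBetween_val_of_leaf {t : ITree} {lo hi w m : ℝ} (a b q : ℝ)
    (ht : (updateMessage t).val = leaf lo hi w m) :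
    (updateBetween a b q t).val = leaf lo hi (w * q) m := by
  rw [updateBetween]
  simp only [bind_val]
  split <;> rename_i heq _ <;> cases ht.symm.trans heq
  simp

theorem updateBetween_val_of_node {t : ITree} {c : Color} {lo hi w m : ℝ} {l h : ITree}
    (a b q : ℝ) (ht : (updateMessage t).val = node c lo hi w m l h) :
    (updateBetween a b q t).val = if b ≤ h.lo then
        (mkNode c (updateBetween a b q l).val h).val
      else if h.lo ≤ a then
        (mkNode c l (updateBetween a b q h).val).val
      else
        (mkNode c (updateFrom a q l).val (updateUpTo b q h).val).val := by
  rw [updateBetween]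
  simp only [bind_val]
  split <;> rename_i heq _ <;> cases ht.symm.trans heq
  by_cases hp : b ≤ h.lo <;> by_cases hp' : h.lo ≤ a <;> simp [hp, hp']

theorem updateBetween_steps_of_leaf {t : ITree} {lo hi w m : ℝ} (a b q : ℝ)
    (ht : (updateMessage t).val = leaf lo hi w m) :
    (updateBetween a b q t).steps = (updateMessage t).steps + 3 := by
  rw [updateBetween]
  simp only [bind_steps]
  split <;> rename_i heq _ <;> cases ht.symm.trans heq
  simp

theorem updateBetween_steps_of_node {t : ITree} {c : Color} {lo hi w m : ℝ} {l h : ITree}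
    (a b q : ℝ) (ht : (updateMessage t).val = node c lo hi w m l h) :
    (updateBetween a b q t).steps ≤ (updateMessage t).steps + 10 +
      max (max (updateBetween a b q l).steps (updateBetween a b q h).steps)
        ((updateFrom a q l).steps + (updateUpTo b q h).steps) := by
  rw [updateBetween]
  simp only [bind_steps]
  split <;> rename_i heq _ <;> cases ht.symm.trans heq
  by_cases hp : b ≤ h.lo <;> by_cases hp' : h.lo ≤ a <;> simp [hp, hp'] <;> omega

theorem descend_leaf_val (lo hi w m x u : ℝ) :
    (descend (leaf lo hi w m) x u).val = (leaf lo hi w m, lo + u * (hi - lo)) := by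
  rw [descend]; rfl

theorem descend_leaf_steps (lo hi w m x u : ℝ) :
    (descend (leaf lo hi w m) x u).steps = 4 := by
  rw [descend]; rfl

theorem descend_node_val (c : Color) (lo hi w m : ℝ) (l h : ITree) (x u : ℝ) :
    (descend (node c lo hi w m l h) x u).val =
      if x < (updateMessage l).val.weight then
        (node c lo hi w m (descend (updateMessage l).val x u).val.1 (updateMessage h).val,
          (descend (updateMessage l).val x u).val.2)
      else
        (node c lo hi w m (updateMessage l).val
            (descend (updateMessage h).val (x - (updateMessage l).val.weight) u).val.1,
          (descend (updateMessage h).val (x - (updateMessage l).val.weight) u).val.2) := by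
  rw [descend]
  by_cases hx : x < (updateMessage l).val.weight <;> simp [hx]

theorem descend_node_steps (c : Color) (lo hi w m : ℝ) (l h : ITree) (x u : ℝ) :
    (descend (node c lo hi w m l h) x u).steps ≤ 63 +
      max (descend (updateMessage l).val x u).steps
        (descend (updateMessage h).val (x - (updateMessage l).val.weight) u).steps := by
  have hl := updateMessage_steps_le l
  have hh := updateMessage_steps_le h
  rw [descend]
  by_cases hx : x < (updateMessage l).val.weight <;> simp [hx] <;> omega

theorem draw_val (t : ITree) (z : ℝ × ℝ) :
    (draw t z).val = (descend (updateMessage t).val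
      (z.1 * (updateMessage t).val.weight) z.2).val := rfl

theorem draw_steps (t : ITree) (z : ℝ × ℝ) :
    (draw t z).steps ≤ 33 + (descend (updateMessage t).val
      (z.1 * (updateMessage t).val.weight) z.2).steps := by
  have h := updateMessage_steps_le t
  simp only [draw, bind_steps, op_steps, op_val]
  omega

/-- The recursion scheme of the operations that apply `updateMessage` to their argument and then
recurse on the children of the result. -/
theorem updateMessage_induction {P : ITree → Prop}
    (leaf : ∀ t lo hi w m, (updateMessage t).val = ITree.leaf lo hi w m → P t)
    (node : ∀ t c lo hi w m l h, (updateMessage t).val = ITree.node c lo hi w m l h →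
      P l → P h → P t) (t : ITree) : P t := by
  induction hn : t.size using Nat.strong_induction_on generalizing t with
  | _ n ih =>
    cases ht : (updateMessage t).val with
    | leaf lo hi w m => exact leaf t lo hi w m ht
    | node c lo hi w m l h =>
      have hs := size_updateMessage t
      rw [ht] at hs
      simp only [ITree.size] at hs
      exact node t c lo hi w m l h ht (ih _ (by omega) l rfl) (ih _ (by omega) h rfl)

/-- The recursion scheme of `descend`. -/
theorem descend_induction {P : ITree → Prop}
    (leaf : ∀ lo hi w m, P (ITree.leaf lo hi w m))
    (node : ∀ c lo hi w m l h, P (updateMessage l).val → P (updateMessage h).val →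
      P (ITree.node c lo hi w m l h)) (t : ITree) : P t := by
  induction hn : t.size using Nat.strong_induction_on generalizing t with
  | _ n ih =>
    cases t with
    | leaf lo hi w m => exact leaf lo hi w m
    | node c lo hi w m l h =>
      simp only [ITree.size] at hn
      exact node c lo hi w m l h (ih _ (by rw [size_updateMessage]; omega) _ rfl)
        (ih _ (by rw [size_updateMessage]; omega) _ rfl)

/-! ### Red-black trees -/

namespace ITree

/-- The shape and the colours of a tree: all numbers are replaced by `0`. -/
def skeleton : ITree → ITree
  | leaf _ _ _ _ => leaf 0 0 0 0
  | node c _ _ _ _ l h => node c 0 0 0 0 l.skeleton h.skeleton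

/-- The number of edges on a longest path from the root to a leaf. -/
def depth : ITree → ℕ
  | leaf _ _ _ _ => 0
  | node _ _ _ _ _ l h => max l.depth h.depth + 1

/-- The number of leaves. -/
def numLeaves : ITree → ℕ
  | leaf _ _ _ _ => 1
  | node _ _ _ _ _ l h => l.numLeaves + h.numLeaves

/-- The root is red; leaves count as black. -/
def IsRed : ITree → Prop
  | node red _ _ _ _ _ _ => True
  | _ => False

/-- Red-black trees of black height `n`, where leaves do not contribute to the height: no red node
has a red child, and every path from the root to a leaf meets `n` black internal nodes. The root
may be red. -/
def IsRedBlack : ℕ → ITree → Prop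
  | n, leaf _ _ _ _ => n = 0
  | n, node red _ _ _ _ l h => l.IsRedBlack n ∧ h.IsRedBlack n ∧ ¬ l.IsRed ∧ ¬ h.IsRed
  | n, node black _ _ _ _ l h => ∃ m, n = m + 1 ∧ l.IsRedBlack m ∧ h.IsRedBlack m

/-- Like `IsRedBlack n`, but a red root may have one red child: the state in which a recursive
insertion leaves a subtree. -/
def IsAlmostRedBlack : ℕ → ITree → Prop
  | n, node red _ _ _ _ l h => l.IsRedBlack n ∧ h.IsRedBlack n ∧ (¬ l.IsRed ∨ ¬ h.IsRed)
  | n, t => t.IsRedBlack n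

end ITree

theorem depth_skeleton (t : ITree) : t.skeleton.depth = t.depth := by
  induction t <;> simp_all [skeleton, depth]

theorem numLeaves_skeleton (t : ITree) : t.skeleton.numLeaves = t.numLeaves := by
  induction t <;> simp_all [skeleton, numLeaves]

theorem isRed_skeleton (t : ITree) : t.skeleton.IsRed ↔ t.IsRed := by
  cases t with
  | leaf => simp [skeleton, IsRed]
  | node c => cases c <;> simp [skeleton, IsRed]

theorem isRedBlack_skeleton (n : ℕ) (t : ITree) : t.skeleton.IsRedBlack n ↔ t.IsRedBlack n := by
  induction t generalizing n with
  | leaf => simp [skeleton, IsRedBlack]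
  | node c _ _ _ _ _ _ hl hh =>
    cases c <;> simp [skeleton, IsRedBlack, isRed_skeleton, hl, hh]

theorem depth_congr {s t : ITree} (h : s.skeleton = t.skeleton) : s.depth = t.depth := by
  rw [← depth_skeleton, h, depth_skeleton]

theorem numLeaves_congr {s t : ITree} (h : s.skeleton = t.skeleton) :
    s.numLeaves = t.numLeaves := by
  rw [← numLeaves_skeleton, h, numLeaves_skeleton]

theorem isRed_congr {s t : ITree} (h : s.skeleton = t.skeleton) : s.IsRed ↔ t.IsRed := by
  rw [← isRed_skeleton, h, isRed_skeleton]

theorem isRedBlack_congr {s t : ITree} (h : s.skeleton = t.skeleton) (n : ℕ) :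
    s.IsRedBlack n ↔ t.IsRedBlack n := by
  rw [← isRedBlack_skeleton, h, isRedBlack_skeleton]

@[simp] theorem skeleton_mulMsg (q : ℝ) (t : ITree) : (mulMsg q t).val.skeleton = t.skeleton := by
  cases t <;> simp [skeleton]

@[simp] theorem skeleton_setMsg (q : ℝ) (t : ITree) : (setMsg q t).val.skeleton = t.skeleton := by
  cases t <;> simp [skeleton]

@[simp] theorem skeleton_settle (t : ITree) : (settle t).val.skeleton = t.skeleton := by
  cases t <;> simp [skeleton]

@[simp] theorem skeleton_updateMessage (t : ITree) :
    (updateMessage t).val.skeleton = t.skeleton := by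
  cases t <;> simp [skeleton]

theorem skeleton_eq_of_updateMessage {s t : ITree} (h : (updateMessage t).val = s) :
    s.skeleton = t.skeleton := by
  rw [← h, skeleton_updateMessage]

theorem skeleton_descend (t : ITree) (x u : ℝ) :
    (descend t x u).val.1.skeleton = t.skeleton := by
  induction t using descend_induction generalizing x with
  | leaf => simp [descend_leaf_val]
  | node c lo hi w m l h hl hh =>
    rw [descend_node_val]
    split_ifs <;> simp [skeleton, hl, hh]

theorem skeleton_draw (t : ITree) (z : ℝ × ℝ) : (draw t z).val.1.skeleton = t.skeleton := by
  rw [draw_val, skeleton_descend, skeleton_updateMessage]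

theorem skeleton_updateFrom (a q : ℝ) (t : ITree) :
    (updateFrom a q t).val.skeleton = t.skeleton := by
  induction t using updateMessage_induction with
  | leaf t lo hi w m ht =>
    rw [updateFrom_val_of_leaf a q ht, ← skeleton_eq_of_updateMessage ht]; rfl
  | node t c lo hi w m l h ht hl hh =>
    rw [updateFrom_val_of_node a q ht, ← skeleton_eq_of_updateMessage ht]
    split_ifs <;> simp [skeleton, hl, hh]

theorem skeleton_updateUpTo (b q : ℝ) (t : ITree) :
    (updateUpTo b q t).val.skeleton = t.skeleton := by
  induction t using updateMessage_induction with
  | leaf t lo hi w m ht =>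
    rw [updateUpTo_val_of_leaf b q ht, ← skeleton_eq_of_updateMessage ht]; rfl
  | node t c lo hi w m l h ht hl hh =>
    rw [updateUpTo_val_of_node b q ht, ← skeleton_eq_of_updateMessage ht]
    split_ifs <;> simp [skeleton, hl, hh]

theorem skeleton_updateBetween (a b q : ℝ) (t : ITree) :
    (updateBetween a b q t).val.skeleton = t.skeleton := by
  induction t using updateMessage_induction with
  | leaf t lo hi w m ht =>
    rw [updateBetween_val_of_leaf a b q ht, ← skeleton_eq_of_updateMessage ht]; rfl
  | node t c lo hi w m l h ht hl hh =>
    rw [updateBetween_val_of_node a b q ht, ← skeleton_eq_of_updateMessage ht]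
    split_ifs <;> simp [skeleton, hl, hh, skeleton_updateFrom, skeleton_updateUpTo]

theorem IsRedBlack.isAlmostRedBlack {n : ℕ} {t : ITree} (h : t.IsRedBlack n) :
    t.IsAlmostRedBlack n := by
  cases t with
  | leaf => exact h
  | node c =>
    cases c with
    | red => exact ⟨h.1, h.2.1, Or.inl h.2.2.1⟩
    | black => exact h

theorem ITree.IsRed.eq_node {t : ITree} (h : t.IsRed) :
    ∃ lo hi w m l r, t = node red lo hi w m l r := by
  cases t with
  | leaf => exact h.elim
  | node c =>
    cases c with
    | red => exact ⟨_, _, _, _, _, _, rfl⟩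
    | black => exact h.elim

theorem isRedBlack_balanceLeft {n : ℕ} {l h : ITree} (hl : l.IsAlmostRedBlack n)
    (hh : h.IsRedBlack n) : (balanceLeft black l h).val.IsRedBlack (n + 1) := by
  unfold balanceLeft
  split <;> simp_all [IsAlmostRedBlack, IsRedBlack, IsRed]
  rename_i l _ _ _ _ hn₁ hn₂
  cases l with
  | leaf => exact hl
  | node c _ _ _ _ l₁ l₂ =>
    cases c with
    | black => exact hl
    | red =>
      obtain ⟨h₁, h₂, -⟩ := hl
      refine ⟨h₁, h₂, fun hr => ?_, fun hr => ?_⟩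
      · obtain ⟨_, _, _, _, _, _, rfl⟩ := hr.eq_node
        exact hn₁ _ _ _ _ _ _ _ _ _ _ _ rfl
      · obtain ⟨_, _, _, _, _, _, rfl⟩ := hr.eq_node
        exact hn₂ _ _ _ _ _ _ _ _ _ _ _ rfl

theorem isRedBlack_balanceRight {n : ℕ} {l h : ITree} (hl : l.IsRedBlack n)
    (hh : h.IsAlmostRedBlack n) : (balanceRight black l h).val.IsRedBlack (n + 1) := by
  unfold balanceRight
  split <;> simp_all [IsAlmostRedBlack, IsRedBlack, IsRed]
  rename_i h _ _ _ hn₁ hn₂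
  cases h with
  | leaf => exact hh
  | node c _ _ _ _ l₁ l₂ =>
    cases c with
    | black => exact hh
    | red =>
      obtain ⟨h₁, h₂, -⟩ := hh
      refine ⟨h₁, h₂, fun hr => ?_, fun hr => ?_⟩
      · obtain ⟨_, _, _, _, _, _, rfl⟩ := hr.eq_node
        exact hn₁ _ _ _ _ _ _ _ _ _ _ _ rfl
      · obtain ⟨_, _, _, _, _, _, rfl⟩ := hr.eq_node
        exact hn₂ _ _ _ _ _ _ _ _ _ _ _ rfl

/-- Insertion into a red-black tree keeps the black height, and can create a red node with a red
child only at the root, and only if the root was red before. -/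
theorem isRedBlack_splitAt (p : ℝ) {n : ℕ} {t : ITree} (h : t.IsRedBlack n) :
    (splitAt p t).val.IsAlmostRedBlack n ∧ (¬ t.IsRed → (splitAt p t).val.IsRedBlack n) := by
  induction t using updateMessage_induction generalizing n with
  | leaf t lo hi w m ht =>
    rw [← isRedBlack_congr (skeleton_eq_of_updateMessage ht)] at h
    have : (splitAt p t).val.IsRedBlack n := by
      rw [splitAt_val_of_leaf p ht]
      split_ifs
      · exact ⟨h, h, id, id⟩
      · exact h
    exact ⟨IsRedBlack.isAlmostRedBlack this, fun _ => this⟩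
  | node t c lo hi w m l r ht hl hr =>
    rw [← isRedBlack_congr (skeleton_eq_of_updateMessage ht)] at h
    rw [splitAt_val_of_node p ht, ← isRed_congr (skeleton_eq_of_updateMessage ht)]
    cases c with
    | red =>
      obtain ⟨h₁, h₂, h₃, h₄⟩ := h
      refine ⟨?_, fun hn => (hn trivial).elim⟩
      split_ifs
      · exact ⟨(hl h₁).2 h₃, h₂, Or.inr h₄⟩
      · exact ⟨h₁, (hr h₂).2 h₄, Or.inl h₃⟩
    | black =>
      obtain ⟨k, rfl, h₁, h₂⟩ := h
      suffices hs : IsRedBlack (k + 1) (if p < r.lo then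
          (balanceLeft black (splitAt p l).val r).val
          else (balanceRight black l (splitAt p r).val).val) from
        ⟨IsRedBlack.isAlmostRedBlack hs, fun _ => hs⟩
      split_ifs
      · exact isRedBlack_balanceLeft (hl h₁).1 h₂
      · exact isRedBlack_balanceRight h₁ (hr h₂).1

theorem isRedBlack_blacken {n : ℕ} {t : ITree} (h : t.IsAlmostRedBlack n) :
    ∃ n', (blacken t).val.IsRedBlack n' := by
  cases t with
  | leaf => exact ⟨n, h⟩
  | node c =>
    cases c with
    | red => exact ⟨n + 1, n, rfl, h.1, h.2.1⟩
    | black => exact ⟨n, h⟩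

theorem numLeaves_balanceLeft (c : Color) (l h : ITree) :
    (balanceLeft c l h).val.numLeaves = l.numLeaves + h.numLeaves := by
  unfold balanceLeft
  split <;> simp [numLeaves] <;> omega

theorem numLeaves_balanceRight (c : Color) (l h : ITree) :
    (balanceRight c l h).val.numLeaves = l.numLeaves + h.numLeaves := by
  unfold balanceRight
  split <;> simp [numLeaves] <;> omega

theorem numLeaves_splitAt_le (p : ℝ) (t : ITree) :
    (splitAt p t).val.numLeaves ≤ t.numLeaves + 1 := by
  induction t using updateMessage_induction with
  | leaf t lo hi w m ht =>
    rw [splitAt_val_of_leaf p ht, ← numLeaves_congr (skeleton_eq_of_updateMessage ht)]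
    split_ifs <;> simp [numLeaves]
  | node t c lo hi w m l h ht hl hh =>
    rw [splitAt_val_of_node p ht, ← numLeaves_congr (skeleton_eq_of_updateMessage ht)]
    split_ifs
    · rw [numLeaves_balanceLeft, numLeaves]; omega
    · rw [numLeaves_balanceRight, numLeaves]; omega

theorem numLeaves_blacken (t : ITree) : (blacken t).val.numLeaves = t.numLeaves := by
  cases t <;> rfl

theorem two_pow_le_numLeaves {n : ℕ} {t : ITree} (h : t.IsRedBlack n) : 2 ^ n ≤ t.numLeaves := by
  induction t generalizing n with
  | leaf => simp_all [IsRedBlack, numLeaves]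
  | node c lo hi w m l r hl hr =>
    cases c with
    | red => exact (hl h.1).trans (Nat.le_add_right _ _)
    | black =>
      obtain ⟨k, rfl, h₁, h₂⟩ := h
      have := hl h₁
      have := hr h₂
      rw [numLeaves, pow_succ]
      omega

theorem depth_le_of_isRedBlack {n : ℕ} {t : ITree} (h : t.IsRedBlack n) :
    t.depth ≤ 2 * n + 1 ∧ (¬ t.IsRed → t.depth ≤ 2 * n) := by
  induction t generalizing n with
  | leaf => simp [depth]
  | node c lo hi w m l r hl hr =>
    cases c with
    | red =>
      have h₁ := (hl h.1).2 h.2.2.1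
      have h₂ := (hr h.2.1).2 h.2.2.2
      exact ⟨by simp only [depth]; omega, fun hn => (hn trivial).elim⟩
    | black =>
      obtain ⟨k, rfl, h₁, h₂⟩ := h
      have := (hl h₁).1
      have := (hr h₂).1
      simp only [depth]
      omega

/-- A red-black tree has logarithmic depth. -/
theorem depth_le_log {n : ℕ} {t : ITree} (h : t.IsRedBlack n) :
    t.depth ≤ 2 * Nat.log 2 t.numLeaves + 1 := by
  have h₁ := (depth_le_of_isRedBlack h).1
  have h₂ := Nat.le_log_of_pow_le (by norm_num) (two_pow_le_numLeaves h)
  omega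

/-! ### Running times in terms of the depth -/

/-- Visiting a node costs at most `64` elementary operations, in this and in the other recursions
that follow a single path. -/
theorem splitAt_steps_le (p : ℝ) (t : ITree) : (splitAt p t).steps ≤ 64 * (t.depth + 1) := by
  induction t using updateMessage_induction with
  | leaf t lo hi w m ht =>
    have h₁ := splitAt_steps_of_leaf p ht
    have h₂ := updateMessage_steps_le t
    omega
  | node t c lo hi w m l h ht hl hh =>
    have h₁ := splitAt_steps_of_node p ht
    have h₂ := updateMessage_steps_le t
    rw [← depth_congr (skeleton_eq_of_updateMessage ht), depth]
    omega

theorem updateFrom_steps_le (a q : ℝ) (t : ITree) :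
    (updateFrom a q t).steps ≤ 64 * (t.depth + 1) := by
  induction t using updateMessage_induction with
  | leaf t lo hi w m ht =>
    have h₁ := updateFrom_steps_of_leaf a q ht
    have h₂ := updateMessage_steps_le t
    omega
  | node t c lo hi w m l h ht hl hh =>
    have h₁ := updateFrom_steps_of_node a q ht
    have h₂ := updateMessage_steps_le t
    rw [← depth_congr (skeleton_eq_of_updateMessage ht), depth]
    omega

theorem updateUpTo_steps_le (b q : ℝ) (t : ITree) :
    (updateUpTo b q t).steps ≤ 64 * (t.depth + 1) := by
  induction t using updateMessage_induction with
  | leaf t lo hi w m ht =>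
    have h₁ := updateUpTo_steps_of_leaf b q ht
    have h₂ := updateMessage_steps_le t
    omega
  | node t c lo hi w m l h ht hl hh =>
    have h₁ := updateUpTo_steps_of_node b q ht
    have h₂ := updateMessage_steps_le t
    rw [← depth_congr (skeleton_eq_of_updateMessage ht), depth]
    omega

/-- The path forks once, into a call of `updateFrom` and one of `updateUpTo`. -/
theorem updateBetween_steps_le (a b q : ℝ) (t : ITree) :
    (updateBetween a b q t).steps ≤ 128 * (t.depth + 1) := by
  induction t using updateMessage_induction with
  | leaf t lo hi w m ht =>
    have h₁ := updateBetween_steps_of_leaf a b q ht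
    have h₂ := updateMessage_steps_le t
    omega
  | node t c lo hi w m l h ht hl hh =>
    have h₁ := updateBetween_steps_of_node a b q ht
    have h₂ := updateMessage_steps_le t
    have h₃ := updateFrom_steps_le a q l
    have h₄ := updateUpTo_steps_le b q h
    rw [← depth_congr (skeleton_eq_of_updateMessage ht), depth]
    omega

theorem descend_steps_le (t : ITree) (x u : ℝ) :
    (descend t x u).steps ≤ 64 * (t.depth + 1) := by
  induction t using descend_induction generalizing x with
  | leaf => simp [descend_leaf_steps, depth]
  | node c lo hi w m l h hl hh =>
    have h₁ := descend_node_steps c lo hi w m l h x u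
    have h₂ := hl x
    have h₃ := hh (x - (updateMessage l).val.weight)
    rw [depth_congr (skeleton_updateMessage _)] at h₂ h₃
    rw [depth]
    omega

theorem draw_steps_le (t : ITree) (z : ℝ × ℝ) :
    (draw t z).steps ≤ 33 + 64 * (t.depth + 1) := by
  have h := descend_steps_le (updateMessage t).val (z.1 * (updateMessage t).val.weight) z.2
  rw [depth_congr (skeleton_updateMessage _)] at h
  exact (draw_steps t z).trans (Nat.add_le_add_left h _)

/-! ### Trees that represent a density -/

namespace ITree

/-- The tree represents the density `g` when the product of the messages above its root is `c`:
its intervals fit together, the stored weight of an internal node is the sum of the weights of its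
children after their own messages, the effective weight of a leaf is the length of its interval
times the value of `g` there, and no point of `S` lies in the interior of the interval of a
leaf. -/
def Represents (S : Set ℝ) (g : ℝ → ℝ) : ℝ → ITree → Prop
  | c, leaf lo hi w m =>
      lo < hi ∧ (∀ p ∈ S, ¬ (lo < p ∧ p < hi)) ∧ ∀ x ∈ Ico lo hi, w * m * c = (hi - lo) * g x
  | c, node _ lo hi w m l h =>
      l.lo = lo ∧ l.hi = h.lo ∧ h.hi = hi ∧ w = l.weight * l.msg + h.weight * h.msg ∧
        l.Represents S g (c * m) ∧ h.Represents S g (c * m)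

/-- The root and its children have message `1`. -/
def IsSettled : ITree → Prop
  | leaf _ _ _ m => m = 1
  | node _ _ _ _ m l h => m = 1 ∧ l.msg = 1 ∧ h.msg = 1

/-- The root and its children have message `1`, and so do the grandchildren that a rotation at the
parent of the root would move. -/
def IsRotatable (t : ITree) : Prop :=
  t.IsSettled ∧ match t with
    | node red _ _ _ _ l h => (l.IsRed → l.IsSettled) ∧ (h.IsRed → h.IsSettled)
    | _ => True

end ITree

theorem ITree.Represents.lo_lt_hi {S : Set ℝ} {g : ℝ → ℝ} {c : ℝ} {t : ITree}
    (ht : t.Represents S g c) : t.lo < t.hi := by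
  induction t generalizing c with
  | leaf => exact ht.1
  | node _ lo hi w m l h hl hh =>
    obtain ⟨h₁, h₂, h₃, -, h₄, h₅⟩ := ht
    have := hl h₄
    have := hh h₅
    simp only [ITree.lo, ITree.hi]
    linarith

theorem ITree.Represents.isIntervalTree {S : Set ℝ} {g : ℝ → ℝ} {c : ℝ} {t : ITree}
    (ht : t.Represents S g c) : t.IsIntervalTree := by
  induction t generalizing c with
  | leaf => exact ht.1
  | node _ lo hi w m l h hl hh =>
    obtain ⟨h₁, h₂, h₃, -, h₄, h₅⟩ := ht
    exact ⟨h₁, h₂, h₃, hl h₄, hh h₅⟩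

theorem ITree.Represents.mono {S S' : Set ℝ} {g : ℝ → ℝ} {c : ℝ} {t : ITree}
    (ht : t.Represents S g c) (hS : S' ⊆ S) : t.Represents S' g c := by
  induction t generalizing c with
  | leaf => exact ⟨ht.1, fun p hp => ht.2.1 p (hS hp), ht.2.2⟩
  | node _ lo hi w m l h hl hh =>
    obtain ⟨h₁, h₂, h₃, h₀, h₄, h₅⟩ := ht
    exact ⟨h₁, h₂, h₃, h₀, hl h₄, hh h₅⟩

theorem ITree.Represents.insert_of_notMem {S : Set ℝ} {g : ℝ → ℝ} {c : ℝ} {t : ITree} {p : ℝ}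
    (ht : t.Represents S g c) (hp : p ≤ t.lo ∨ t.hi ≤ p) :
    t.Represents (insert p S) g c := by
  induction t generalizing c with
  | leaf lo hi w m =>
    refine ⟨ht.1, ?_, ht.2.2⟩
    rintro s (rfl | hs) ⟨h₁, h₂⟩
    · simp only [ITree.lo, ITree.hi] at hp
      rcases hp with hp | hp <;> linarith
    · exact ht.2.1 s hs ⟨h₁, h₂⟩
  | node _ lo hi w m l h hl hh =>
    obtain ⟨h₁, h₂, h₃, h₀, h₄, h₅⟩ := ht
    have hl' := h₄.lo_lt_hi
    have hh' := h₅.lo_lt_hi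
    simp only [ITree.lo, ITree.hi] at hp
    refine ⟨h₁, h₂, h₃, h₀, hl h₄ ?_, hh h₅ ?_⟩ <;>
      rcases hp with hp | hp <;> first | (left; linarith) | (right; linarith)

/-- Multiplying the density by `q` on the interval of the tree is the same as multiplying the
message above it by `q`. -/
theorem ITree.Represents.scale {S : Set ℝ} {g g' : ℝ → ℝ} {c q : ℝ} {t : ITree}
    (ht : t.Represents S g c) (hg : ∀ x ∈ Ico t.lo t.hi, g' x = q * g x) :
    t.Represents S g' (c * q) := by
  induction t generalizing c with
  | leaf lo hi w m =>
    refine ⟨ht.1, ht.2.1, fun x hx => ?_⟩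
    rw [hg x hx, ← mul_assoc, ht.2.2 x hx]
    ring
  | node _ lo hi w m l h hl hh =>
    obtain ⟨h₁, h₂, h₃, h₀, h₄, h₅⟩ := ht
    have hl' := h₄.lo_lt_hi
    have hh' := h₅.lo_lt_hi
    simp only [ITree.lo, ITree.hi] at hg
    refine ⟨h₁, h₂, h₃, h₀, ?_, ?_⟩ <;> rw [mul_right_comm]
    · exact hl h₄ fun x hx => hg x ⟨by linarith [hx.1], by linarith [hx.2]⟩
    · exact hh h₅ fun x hx => hg x ⟨by linarith [hx.1], by linarith [hx.2]⟩

theorem ITree.Represents.congr {S : Set ℝ} {g g' : ℝ → ℝ} {c : ℝ} {t : ITree}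
    (ht : t.Represents S g c) (hg : ∀ x ∈ Ico t.lo t.hi, g' x = g x) :
    t.Represents S g' c := by
  simpa using ht.scale (q := 1) (g' := g') (by simpa using hg)

@[simp] theorem mulMsg_lo (q : ℝ) (t : ITree) : (mulMsg q t).val.lo = t.lo := by cases t <;> rfl

@[simp] theorem mulMsg_hi (q : ℝ) (t : ITree) : (mulMsg q t).val.hi = t.hi := by cases t <;> rfl

@[simp] theorem mulMsg_weight (q : ℝ) (t : ITree) : (mulMsg q t).val.weight = t.weight := by
  cases t <;> rfl

@[simp] theorem mulMsg_msg (q : ℝ) (t : ITree) : (mulMsg q t).val.msg = t.msg * q := by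
  cases t <;> rfl

@[simp] theorem settle_lo (t : ITree) : (settle t).val.lo = t.lo := by cases t <;> rfl

@[simp] theorem settle_hi (t : ITree) : (settle t).val.hi = t.hi := by cases t <;> rfl

@[simp] theorem settle_weight (t : ITree) : (settle t).val.weight = t.weight * t.msg := by
  cases t <;> rfl

@[simp] theorem settle_msg (t : ITree) : (settle t).val.msg = 1 := by cases t <;> rfl

@[simp] theorem updateMessage_lo (t : ITree) : (updateMessage t).val.lo = t.lo := by
  cases t <;> rfl

@[simp] theorem updateMessage_hi (t : ITree) : (updateMessage t).val.hi = t.hi := by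
  cases t <;> rfl

@[simp] theorem updateMessage_weight (t : ITree) :
    (updateMessage t).val.weight = t.weight * t.msg := by
  cases t <;> rfl

@[simp] theorem updateMessage_msg (t : ITree) : (updateMessage t).val.msg = 1 := by
  cases t <;> rfl

theorem isSettled_updateMessage (t : ITree) : (updateMessage t).val.IsSettled := by
  cases t <;> simp [IsSettled]

theorem ITree.IsSettled.msg_eq_one {t : ITree} (h : t.IsSettled) : t.msg = 1 := by
  cases t with
  | leaf => exact h
  | node => exact h.1

theorem represents_mulMsg {S : Set ℝ} {g : ℝ → ℝ} {c q : ℝ} {t : ITree} :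
    (mulMsg q t).val.Represents S g c ↔ t.Represents S g (c * q) := by
  cases t with
  | leaf lo hi w m => simp only [mulMsg_leaf_val, Represents, mul_left_comm, mul_comm]
  | node _ lo hi w m l h =>
    simp only [mulMsg_node_val, Represents, mul_right_comm c q m, mul_assoc c m q]

theorem setMsg_val_of_msg_eq_one (q : ℝ) {t : ITree} (h : t.msg = 1) :
    (setMsg q t).val = (mulMsg q t).val := by
  cases t <;> simp_all [msg]

theorem ITree.Represents.settled {S : Set ℝ} {g : ℝ → ℝ} {c : ℝ} {t : ITree}
    (ht : t.Represents S g c) : (settle t).val.Represents S g c := by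
  cases t with
  | leaf lo hi w m => simpa [Represents] using ht
  | node _ lo hi w m l h =>
    obtain ⟨h₁, h₂, h₃, rfl, h₄, h₅⟩ := ht
    refine ⟨by simpa, by simpa, by simpa, by simp; ring, ?_, ?_⟩ <;>
      simpa [represents_mulMsg]

theorem ITree.Represents.updated {S : Set ℝ} {g : ℝ → ℝ} {c : ℝ} {t : ITree}
    (ht : t.Represents S g c) : (updateMessage t).val.Represents S g c := by
  have hs := ht.settled
  cases t with
  | leaf lo hi w m => exact hs
  | node _ lo hi w m l h =>
    obtain ⟨h₁, h₂, h₃, h₀, h₄, h₅⟩ := hs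
    exact ⟨by simpa using h₁, by simpa using h₂, by simpa using h₃, by simpa using h₀,
      h₄.settled, h₅.settled⟩

theorem ITree.Represents.of_updateMessage_leaf {S : Set ℝ} {g : ℝ → ℝ} {t : ITree} {lo hi w m : ℝ}
    (ht : t.Represents S g 1) (h : (updateMessage t).val = leaf lo hi w m) :
    m = 1 ∧ t.lo = lo ∧ t.hi = hi ∧ lo < hi ∧ (∀ p ∈ S, ¬ (lo < p ∧ p < hi)) ∧
      ∀ x ∈ Ico lo hi, w = (hi - lo) * g x := by
  have h₁ := isSettled_updateMessage t
  have h₂ := ht.updated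
  have h₃ := updateMessage_lo t
  have h₄ := updateMessage_hi t
  rw [h] at h₁ h₂ h₃ h₄
  obtain rfl : m = 1 := h₁
  obtain ⟨h₅, h₆, h₇⟩ := h₂
  exact ⟨rfl, h₃.symm, h₄.symm, h₅, h₆, by simpa using h₇⟩

theorem ITree.Represents.of_updateMessage_node {S : Set ℝ} {g : ℝ → ℝ} {t : ITree} {c : Color}
    {lo hi w m : ℝ} {l r : ITree} (ht : t.Represents S g 1)
    (h : (updateMessage t).val = node c lo hi w m l r) :
    m = 1 ∧ l.msg = 1 ∧ r.msg = 1 ∧ (l.lo = lo ∧ t.lo = lo) ∧ l.hi = r.lo ∧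
      (r.hi = hi ∧ t.hi = hi) ∧ w = l.weight + r.weight ∧
      l.Represents S g 1 ∧ r.Represents S g 1 := by
  have h₁ := isSettled_updateMessage t
  have h₂ := ht.updated
  have h₃ := updateMessage_lo t
  have h₄ := updateMessage_hi t
  rw [h] at h₁ h₂ h₃ h₄
  obtain ⟨rfl, h₅, h₆⟩ := h₁
  obtain ⟨h₇, h₈, h₉, h₀, hl, hr⟩ := h₂
  rw [mul_one] at hl hr
  exact ⟨rfl, h₅, h₆, ⟨h₇, h₃.symm⟩, h₈, ⟨h₉, h₄.symm⟩, by simpa [h₅, h₆] using h₀, hl, hr⟩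

/-! ### Insertion -/

theorem represents_mkNode {S : Set ℝ} {g : ℝ → ℝ} {l h : ITree} (c : Color)
    (hl : l.Represents S g 1) (hh : h.Represents S g 1) (hlh : l.hi = h.lo)
    (hml : l.msg = 1) (hmh : h.msg = 1) : (mkNode c l h).val.Represents S g 1 := by
  refine ⟨rfl, hlh, rfl, by simp [hml, hmh], ?_, ?_⟩ <;> simpa

/-- Rotations recompute the weights of the nodes that they build from the stored weights of the
moved subtrees, which is correct because these subtrees have message `1`. -/
theorem represents_balanceLeft {S : Set ℝ} {g : ℝ → ℝ} {l h : ITree}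
    (hl : l.Represents S g 1) (hh : h.Represents S g 1) (hlh : l.hi = h.lo)
    (hml : l.IsRotatable) (hmh : h.msg = 1) :
    (balanceLeft black l h).val.Represents S g 1 ∧ (balanceLeft black l h).val.lo = l.lo ∧
      (balanceLeft black l h).val.hi = h.hi ∧ (balanceLeft black l h).val.IsRotatable := by
  unfold balanceLeft
  split
  · obtain ⟨⟨rfl, h₁, h₂⟩, h₃, -⟩ := hml
    obtain ⟨rfl, h₄, h₅⟩ := h₃ trivial
    simp_all [Represents, ITree.lo, ITree.hi, ITree.weight, ITree.msg, IsRotatable, IsSettled,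
      IsRed]
  · obtain ⟨⟨rfl, h₁, h₂⟩, -, h₃⟩ := hml
    obtain ⟨rfl, h₄, h₅⟩ := h₃ trivial
    simp_all [Represents, ITree.lo, ITree.hi, ITree.weight, ITree.msg, IsRotatable, IsSettled,
      IsRed]
  · exact ⟨represents_mkNode _ hl hh hlh hml.1.msg_eq_one hmh, rfl, rfl,
      ⟨rfl, hml.1.msg_eq_one, hmh⟩, trivial⟩

theorem represents_balanceRight {S : Set ℝ} {g : ℝ → ℝ} {l h : ITree}
    (hl : l.Represents S g 1) (hh : h.Represents S g 1) (hlh : l.hi = h.lo)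
    (hml : l.msg = 1) (hmh : h.IsRotatable) :
    (balanceRight black l h).val.Represents S g 1 ∧ (balanceRight black l h).val.lo = l.lo ∧
      (balanceRight black l h).val.hi = h.hi ∧ (balanceRight black l h).val.IsRotatable := by
  unfold balanceRight
  split
  · obtain ⟨⟨rfl, h₁, h₂⟩, h₃, -⟩ := hmh
    obtain ⟨rfl, h₄, h₅⟩ := h₃ trivial
    simp_all [Represents, ITree.lo, ITree.hi, ITree.weight, ITree.msg, IsRotatable, IsSettled,
      IsRed]
  · obtain ⟨⟨rfl, h₁, h₂⟩, -, h₃⟩ := hmh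
    obtain ⟨rfl, h₄, h₅⟩ := h₃ trivial
    simp_all [Represents, ITree.lo, ITree.hi, ITree.weight, ITree.msg, IsRotatable, IsSettled,
      IsRed]
  · exact ⟨represents_mkNode _ hl hh hlh hml hmh.1.msg_eq_one, rfl, rfl,
      ⟨rfl, hml, hmh.1.msg_eq_one⟩, trivial⟩

/-- Insertion of a break point leaves the represented density unchanged. The red-black property is
needed since a subtree with a red root and a red child that the insertion did not create would be
rotated although its messages may be pending. -/
theorem represents_splitAt {S : Set ℝ} {g : ℝ → ℝ} {n : ℕ} {t : ITree} (p : ℝ)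
    (ht : t.Represents S g 1) (hn : t.IsRedBlack n) :
    (splitAt p t).val.Represents (insert p S) g 1 ∧ (splitAt p t).val.lo = t.lo ∧
      (splitAt p t).val.hi = t.hi ∧ (splitAt p t).val.IsRotatable := by
  induction t using updateMessage_induction generalizing n with
  | leaf t lo hi w m hu =>
    obtain ⟨rfl, h₁, h₂, h₃, h₄, h₅⟩ := ht.of_updateMessage_leaf hu
    rw [splitAt_val_of_leaf p hu, h₁, h₂]
    have hne : hi - lo ≠ 0 := by linarith
    split_ifs with hp
    · obtain ⟨hp₁, hp₂⟩ := hp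
      refine ⟨?_, rfl, rfl, ⟨rfl, rfl, rfl⟩, fun h => h.elim, fun h => h.elim⟩
      refine ⟨rfl, rfl, rfl, by simp [ITree.weight, ITree.msg], ⟨hp₁, ?_, fun x hx => ?_⟩,
        hp₂, ?_, fun x hx => ?_⟩
      · rintro s (rfl | hs) ⟨h₆, h₇⟩
        · exact lt_irrefl _ h₇
        · exact h₄ s hs ⟨h₆, h₇.trans hp₂⟩
      · rw [h₅ x ⟨hx.1, hx.2.trans hp₂⟩]
        field_simp
      · rintro s (rfl | hs) ⟨h₆, h₇⟩
        · exact lt_irrefl _ h₆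
        · exact h₄ s hs ⟨hp₁.trans h₆, h₇⟩
      · rw [h₅ x ⟨hp₁.le.trans hx.1, hx.2⟩]
        field_simp
    · refine ⟨⟨h₃, ?_, by simpa using h₅⟩, rfl, rfl, rfl, trivial⟩
      rintro s (rfl | hs)
      · exact hp
      · exact h₄ s hs
  | node t c lo hi w m l h hu hl hh =>
    rw [← isRedBlack_congr (skeleton_eq_of_updateMessage hu)] at hn
    obtain ⟨rfl, hml, hmh, ⟨h₁, h₁'⟩, h₂, ⟨h₃, h₃'⟩, -, h₄, h₅⟩ := ht.of_updateMessage_node hu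
    rw [splitAt_val_of_node p hu, h₁', h₃', ← h₁, ← h₃]
    cases c with
    | red =>
      obtain ⟨hnl, hnh, hrl, hrh⟩ := hn
      split_ifs with hp
      · obtain ⟨i₁, i₂, i₃, i₄⟩ := hl h₄ hnl
        exact ⟨represents_mkNode _ i₁ (h₅.insert_of_notMem (.inl hp.le)) (i₃.trans h₂)
          i₄.1.msg_eq_one hmh, i₂, rfl, ⟨rfl, i₄.1.msg_eq_one, hmh⟩, fun _ => i₄.1,
          fun h => (hrh h).elim⟩
      · obtain ⟨i₁, i₂, i₃, i₄⟩ := hh h₅ hnh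
        exact ⟨represents_mkNode _ (h₄.insert_of_notMem (.inr (h₂ ▸ not_lt.mp hp))) i₁
          (h₂.trans i₂.symm) hml i₄.1.msg_eq_one, rfl, i₃, ⟨rfl, hml, i₄.1.msg_eq_one⟩,
          fun h => (hrl h).elim, fun _ => i₄.1⟩
    | black =>
      obtain ⟨k, -, hnl, hnh⟩ := hn
      split_ifs with hp
      · obtain ⟨i₁, i₂, i₃, i₄⟩ := hl h₄ hnl
        rw [← i₂]
        exact represents_balanceLeft i₁ (h₅.insert_of_notMem (.inl hp.le)) (i₃.trans h₂) i₄ hmh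
      · obtain ⟨i₁, i₂, i₃, i₄⟩ := hh h₅ hnh
        rw [← i₃]
        exact represents_balanceRight (h₄.insert_of_notMem (.inr (h₂ ▸ not_lt.mp hp))) i₁
          (h₂.trans i₂.symm) hml i₄

theorem represents_blacken {S : Set ℝ} {g : ℝ → ℝ} {c : ℝ} {t : ITree} :
    (blacken t).val.Represents S g c ↔ t.Represents S g c := by
  cases t <;> rfl

@[simp] theorem blacken_lo (t : ITree) : (blacken t).val.lo = t.lo := by cases t <;> rfl

@[simp] theorem blacken_hi (t : ITree) : (blacken t).val.hi = t.hi := by cases t <;> rfl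

theorem represents_insertInterval {S : Set ℝ} {g : ℝ → ℝ} {n : ℕ} {t : ITree} (a b : ℝ)
    (ht : t.Represents S g 1) (hn : t.IsRedBlack n) :
    (insertInterval a b t).val.Represents {a, b} g 1 ∧ (insertInterval a b t).val.lo = t.lo ∧
      (insertInterval a b t).val.hi = t.hi ∧
      ∃ n', (insertInterval a b t).val.IsRedBlack n' := by
  obtain ⟨h₁, h₂, h₃, -⟩ := represents_splitAt a (ht.mono (empty_subset S)) hn
  obtain ⟨k, hk⟩ := isRedBlack_blacken (isRedBlack_splitAt a hn).1
  obtain ⟨h₄, h₅, h₆, -⟩ := represents_splitAt b (represents_blacken.mpr h₁) hk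
  refine ⟨represents_blacken.mpr (h₄.mono ?_), ?_, ?_,
    isRedBlack_blacken (isRedBlack_splitAt b hk).1⟩
  · rintro x (rfl | rfl) <;> simp
  · exact (blacken_lo _).trans (h₅.trans ((blacken_lo _).trans h₂))
  · exact (blacken_hi _).trans (h₆.trans ((blacken_hi _).trans h₃))

/-! ### Multiplication of the density on an interval -/

theorem represents_updateFrom {S : Set ℝ} {g : ℝ → ℝ} {t : ITree} {a : ℝ} (q : ℝ)
    (ht : t.Represents S g 1) (ha : a ∈ S) (hlo : t.lo ≤ a) (hhi : a < t.hi) :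
    (updateFrom a q t).val.Represents S (fun x => if a ≤ x then q * g x else g x) 1 ∧
      (updateFrom a q t).val.lo = t.lo ∧ (updateFrom a q t).val.hi = t.hi ∧
      (updateFrom a q t).val.msg = 1 := by
  induction t using updateMessage_induction with
  | leaf t lo hi w m hu =>
    obtain ⟨rfl, h₁, h₂, h₃, h₄, h₅⟩ := ht.of_updateMessage_leaf hu
    rw [updateFrom_val_of_leaf a q hu, h₁, h₂]
    rw [h₁] at hlo
    rw [h₂] at hhi
    -- `a` is not inside the interval of the leaf, so it is its left end point
    have hle : a ≤ lo := not_lt.mp fun h => h₄ a ha ⟨h, hhi⟩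
    refine ⟨⟨h₃, h₄, fun x hx => ?_⟩, rfl, rfl, rfl⟩
    beta_reduce
    rw [if_pos (hle.trans hx.1), h₅ x hx]
    ring
  | node t c lo hi w m l h hu hl hh =>
    obtain ⟨rfl, hml, hmh, ⟨h₁, h₁'⟩, h₂, ⟨h₃, h₃'⟩, -, h₄, h₅⟩ := ht.of_updateMessage_node hu
    rw [updateFrom_val_of_node a q hu, h₁', h₃']
    rw [h₁', ← h₁] at hlo
    rw [h₃', ← h₃] at hhi
    split_ifs with hp
    · obtain ⟨i₁, i₂, i₃, i₄⟩ := hl h₄ hlo (h₂ ▸ hp)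
      rw [setMsg_val_of_msg_eq_one q hmh]
      refine ⟨⟨i₂.trans h₁, by simpa using i₃.trans h₂, by simpa using h₃, ?_, ?_, ?_⟩,
        rfl, rfl, rfl⟩
      · rw [i₄, mulMsg_weight, mulMsg_msg, hmh]
        ring
      · simpa using i₁
      · rw [represents_mulMsg, mul_one]
        exact h₅.scale fun x hx => if_pos (hp.le.trans hx.1)
    · obtain ⟨i₁, i₂, i₃, i₄⟩ := hh h₅ (not_lt.mp hp) hhi
      refine ⟨⟨h₁, h₂.trans i₂.symm, i₃.trans h₃, by simp [i₄, hml], ?_, by simpa using i₁⟩,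
        rfl, rfl, rfl⟩
      rw [mul_one]
      exact h₄.congr fun x hx =>
        if_neg (not_le.mpr (hx.2.trans_le (h₂.le.trans (not_lt.mp hp))))

theorem represents_updateUpTo {S : Set ℝ} {g : ℝ → ℝ} {t : ITree} {b : ℝ} (q : ℝ)
    (ht : t.Represents S g 1) (hb : b ∈ S) (hlo : t.lo < b) (hhi : b ≤ t.hi) :
    (updateUpTo b q t).val.Represents S (fun x => if x < b then q * g x else g x) 1 ∧
      (updateUpTo b q t).val.lo = t.lo ∧ (updateUpTo b q t).val.hi = t.hi ∧
      (updateUpTo b q t).val.msg = 1 := by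
  induction t using updateMessage_induction with
  | leaf t lo hi w m hu =>
    obtain ⟨rfl, h₁, h₂, h₃, h₄, h₅⟩ := ht.of_updateMessage_leaf hu
    rw [updateUpTo_val_of_leaf b q hu, h₁, h₂]
    rw [h₁] at hlo
    rw [h₂] at hhi
    -- `b` is not inside the interval of the leaf, so it is its right end point
    have hle : hi ≤ b := not_lt.mp fun h => h₄ b hb ⟨hlo, h⟩
    refine ⟨⟨h₃, h₄, fun x hx => ?_⟩, rfl, rfl, rfl⟩
    beta_reduce
    rw [if_pos (hx.2.trans_le hle), h₅ x hx]
    ring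
  | node t c lo hi w m l h hu hl hh =>
    obtain ⟨rfl, hml, hmh, ⟨h₁, h₁'⟩, h₂, ⟨h₃, h₃'⟩, -, h₄, h₅⟩ := ht.of_updateMessage_node hu
    rw [updateUpTo_val_of_node b q hu, h₁', h₃']
    rw [h₁', ← h₁] at hlo
    rw [h₃', ← h₃] at hhi
    split_ifs with hp
    · obtain ⟨i₁, i₂, i₃, i₄⟩ := hl h₄ hlo (h₂ ▸ hp)
      refine ⟨⟨i₂.trans h₁, i₃.trans h₂, h₃, by simp [i₄, hmh], by simpa using i₁, ?_⟩,
        rfl, rfl, rfl⟩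
      rw [mul_one]
      exact h₅.congr fun x hx => if_neg (not_lt.mpr (hp.trans hx.1))
    · rw [not_le] at hp
      obtain ⟨i₁, i₂, i₃, i₄⟩ := hh h₅ hp hhi
      rw [setMsg_val_of_msg_eq_one q hml]
      refine ⟨⟨by simpa using h₁, by simpa using h₂.trans i₂.symm, i₃.trans h₃, ?_, ?_,
        by simpa using i₁⟩, rfl, rfl, rfl⟩
      · rw [i₄, mulMsg_weight, mulMsg_msg, hml]
        ring
      · rw [represents_mulMsg, mul_one]
        exact h₄.scale fun x hx => if_pos (hx.2.trans (h₂.trans_lt hp))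

theorem represents_updateBetween {S : Set ℝ} {g : ℝ → ℝ} {t : ITree} {a b : ℝ} (q : ℝ)
    (ht : t.Represents S g 1) (ha : a ∈ S) (hb : b ∈ S) (hab : a < b) (hlo : t.lo ≤ a)
    (hhi : b ≤ t.hi) :
    (updateBetween a b q t).val.Represents S
        (fun x => if a ≤ x ∧ x < b then q * g x else g x) 1 ∧
      (updateBetween a b q t).val.lo = t.lo ∧ (updateBetween a b q t).val.hi = t.hi ∧
      (updateBetween a b q t).val.msg = 1 := by
  induction t using updateMessage_induction with
  | leaf t lo hi w m hu =>
    obtain ⟨rfl, h₁, h₂, h₃, h₄, h₅⟩ := ht.of_updateMessage_leaf hu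
    rw [updateBetween_val_of_leaf a b q hu, h₁, h₂]
    rw [h₁] at hlo
    rw [h₂] at hhi
    have hle : a ≤ lo := not_lt.mp fun h => h₄ a ha ⟨h, hab.trans_le hhi⟩
    have hge : hi ≤ b := not_lt.mp fun h => h₄ b hb ⟨hlo.trans_lt hab, h⟩
    refine ⟨⟨h₃, h₄, fun x hx => ?_⟩, rfl, rfl, rfl⟩
    beta_reduce
    rw [if_pos ⟨hle.trans hx.1, hx.2.trans_le hge⟩, h₅ x hx]
    ring
  | node t c lo hi w m l h hu hl hh =>
    obtain ⟨rfl, hml, hmh, ⟨h₁, h₁'⟩, h₂, ⟨h₃, h₃'⟩, -, h₄, h₅⟩ := ht.of_updateMessage_node hu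
    rw [updateBetween_val_of_node a b q hu, h₁', h₃', ← h₁, ← h₃]
    rw [h₁', ← h₁] at hlo
    rw [h₃', ← h₃] at hhi
    split_ifs with hp hp'
    · obtain ⟨i₁, i₂, i₃, i₄⟩ := hl h₄ hlo (h₂ ▸ hp)
      exact ⟨represents_mkNode _ i₁
        (h₅.congr fun x hx => if_neg fun h => absurd h.2 (not_lt.mpr (hp.trans hx.1)))
        (i₃.trans h₂) i₄ hmh, i₂, rfl, rfl⟩
    · obtain ⟨i₁, i₂, i₃, i₄⟩ := hh h₅ hp' hhi
      exact ⟨represents_mkNode _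
        (h₄.congr fun x hx => if_neg fun h =>
          absurd h.1 (not_le.mpr (hx.2.trans_le (h₂.le.trans hp')))) i₁
        (h₂.trans i₂.symm) hml i₄, rfl, i₃, rfl⟩
    · rw [not_le] at hp hp'
      obtain ⟨i₁, i₂, i₃, i₄⟩ := represents_updateFrom q h₄ ha hlo (h₂ ▸ hp')
      obtain ⟨j₁, j₂, j₃, j₄⟩ := represents_updateUpTo q h₅ hb hp hhi
      refine ⟨represents_mkNode _ (i₁.congr fun x hx => ?_) (j₁.congr fun x hx => ?_)
        (i₃.trans (h₂.trans j₂.symm)) i₄ j₄, i₂, j₃, rfl⟩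
      · rw [i₃] at hx
        simp [hx.2.trans (h₂.trans_lt hp)]
      · rw [j₂] at hx
        simp [hp'.le.trans hx.1]

theorem represents_update {S : Set ℝ} {g : ℝ → ℝ} {n : ℕ} {t : ITree} {a b : ℝ} (q : ℝ)
    (ht : t.Represents S g 1) (hn : t.IsRedBlack n) (hab : a < b) (hlo : t.lo ≤ a)
    (hhi : b ≤ t.hi) :
    (update a b q t).val.Represents ∅ (fun x => if a ≤ x ∧ x < b then q * g x else g x) 1 ∧
      (update a b q t).val.lo = t.lo ∧ (update a b q t).val.hi = t.hi ∧
      ∃ n', (update a b q t).val.IsRedBlack n' := by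
  obtain ⟨h₁, h₂, h₃, k, h₄⟩ := represents_insertInterval a b ht hn
  obtain ⟨i₁, i₂, i₃, -⟩ := represents_updateBetween q h₁ (by simp) (by simp) hab
    (h₂.trans_le hlo) (hhi.trans_eq h₃.symm)
  exact ⟨i₁.mono (empty_subset _), i₂.trans h₂, i₃.trans h₃, k,
    (isRedBlack_congr (skeleton_updateBetween a b q _) k).mpr h₄⟩

/-! ### Effective weights -/

theorem ITree.Represents.effectiveWeight_pos {S : Set ℝ} {g : ℝ → ℝ} {c : ℝ} {t : ITree}
    (ht : t.Represents S g c) (hg : ∀ x, 0 < g x) : 0 < t.weight * t.msg * c := by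
  induction t generalizing c with
  | leaf lo hi w m =>
    rw [ITree.weight, ITree.msg, ht.2.2 lo ⟨le_rfl, ht.1⟩]
    exact mul_pos (sub_pos.mpr ht.1) (hg lo)
  | node _ lo hi w m l h hl hh =>
    obtain ⟨-, -, -, rfl, h₄, h₅⟩ := ht
    have h₆ := hl h₄
    have h₇ := hh h₅
    change 0 < (l.weight * l.msg + h.weight * h.msg) * m * c
    linarith

theorem ITree.Represents.integral_eq {S : Set ℝ} {g : ℝ → ℝ} {c : ℝ} {t : ITree}
    (ht : t.Represents S g c) : IntervalIntegrable g volume t.lo t.hi ∧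
      ∫ x in t.lo..t.hi, g x = t.weight * t.msg * c := by
  induction t generalizing c with
  | leaf lo hi w m =>
    obtain ⟨hlt, -, hw⟩ := ht
    have hg : EqOn (fun _ => w * m * c / (hi - lo)) g (Ico lo hi) := fun x hx => by
      simp only [hw x hx]
      field_simp [(sub_pos.mpr hlt).ne']
    refine ⟨?_, ?_⟩
    · exact (intervalIntegrable_iff_integrableOn_Ico_of_le hlt.le).mpr
        ((integrableOn_const (by simp)).congr_fun hg measurableSet_Ico)
    · simp only [ITree.lo, ITree.hi, ITree.weight, ITree.msg]
      rw [intervalIntegral.integral_of_le hlt.le, ← integral_Ico_eq_integral_Ioc,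
        ← setIntegral_congr_fun measurableSet_Ico hg]
      simp [hlt.le, mul_div_cancel₀, (sub_pos.mpr hlt).ne']
  | node _ lo hi w m l h hl hh =>
    obtain ⟨h₁, h₂, h₃, rfl, h₄, h₅⟩ := ht
    obtain ⟨i₁, i₂⟩ := hl h₄
    obtain ⟨j₁, j₂⟩ := hh h₅
    rw [h₁, h₂] at i₁ i₂
    rw [h₃] at j₁ j₂
    refine ⟨i₁.trans j₁, ?_⟩
    change ∫ x in lo..hi, g x = (l.weight * l.msg + h.weight * h.msg) * m * c
    rw [← intervalIntegral.integral_add_adjacent_intervals i₁ j₁, i₂, j₂]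
    ring

theorem ITree.Represents.of_mem_nodes {S : Set ℝ} {g : ℝ → ℝ} {c : ℝ} {t : ITree}
    (ht : t.Represents S g c) {N : ℝ × ITree} (hN : N ∈ nodes c t) :
    N.2.Represents S g N.1 := by
  induction t generalizing c with
  | leaf lo hi w m =>
    obtain rfl : N = (c, leaf lo hi w m) := by simpa [nodes] using hN
    exact ht
  | node col lo hi w m l h hl hh =>
    simp only [nodes, List.mem_cons, List.mem_append] at hN
    rcases hN with rfl | hN | hN
    · exact ht
    · exact hl ht.2.2.2.2.1 hN
    · exact hh ht.2.2.2.2.2 hN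

theorem ITree.Represents.omega_eq_sum {S : Set ℝ} {g : ℝ → ℝ} {c : ℝ} {t : ITree}
    (ht : t.Represents S g c) :
    omega (c, t) = ((leavesBelow (c, t)).map omega).sum := by
  induction t generalizing c with
  | leaf lo hi w m => simp [leavesBelow, nodes, isLeaf]
  | node col lo hi w m l h hl hh =>
    obtain ⟨-, -, -, rfl, h₄, h₅⟩ := ht
    have h₆ := hl h₄
    have h₇ := hh h₅
    simp only [leavesBelow, omega, ITree.weight, ITree.msg] at h₆ h₇ ⊢
    rw [nodes, List.filter_cons_of_neg (by simp [isLeaf]), List.filter_append, List.map_append,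
      List.sum_append, ← h₆, ← h₇]
    ring

/-! ### The law of a draw -/

theorem measurable_descend (t : ITree) :
    Measurable fun z : ℝ × ℝ => (descend t z.1 z.2).val.2 := by
  induction t using descend_induction with
  | leaf lo hi w m =>
    simp only [descend_leaf_val]
    fun_prop
  | node c lo hi w m l h hl hh =>
    simp only [descend_node_val, apply_ite Prod.snd]
    exact Measurable.ite (measurableSet_lt measurable_fst measurable_const) hl
      (hh.comp ((measurable_fst.sub_const _).prodMk measurable_snd))

theorem map_sub_restrict_Ico (c d : ℝ) :
    (volume.restrict (Ico c d)).map (fun x : ℝ => x - c) = volume.restrict (Ico 0 (d - c)) := by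
  conv_rhs => rw [← map_sub_right_eq_self volume c]
  rw [Measure.restrict_map (by fun_prop) measurableSet_Ico]
  simp

theorem map_mul_restrict_Ico {d : ℝ} (hd : 0 < d) :
    (volume.restrict (Ico 0 1)).map (fun x : ℝ => x * d) =
      ENNReal.ofReal d⁻¹ • volume.restrict (Ico 0 d) := by
  have h := Measure.restrict_map (μ := volume) (f := fun x : ℝ => x * d) (by fun_prop)
    (measurableSet_Ico (a := 0) (b := d))
  rw [Real.map_volume_mul_right hd.ne', abs_of_pos (inv_pos.mpr hd), Measure.restrict_smul,
    preimage_mul_const_Ico₀ _ _ hd, zero_div, div_self hd.ne'] at h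
  exact h.symm

theorem map_affine_restrict_Ico (c : ℝ) {d : ℝ} (hd : 0 < d) :
    (volume.restrict (Ico 0 1)).map (fun x : ℝ => c + x * d) =
      ENNReal.ofReal d⁻¹ • volume.restrict (Ico c (c + d)) := by
  have h : (fun x : ℝ => c + x * d) = (fun x => c + x) ∘ fun x => x * d := rfl
  rw [h, ← Measure.map_map (by fun_prop) (by fun_prop), map_mul_restrict_Ico hd,
    Measure.map_smul]
  congr 1
  conv_rhs => rw [← map_add_left_eq_self volume c]
  rw [Measure.restrict_map (by fun_prop) measurableSet_Ico]
  simp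

/-- Descending from an up-to-date node with a position uniform in its weight reaches a point
distributed according to the represented density: the two parts into which the node splits the
range of positions are, after translation, the ranges of positions of its children. -/
theorem map_descend {S : Set ℝ} {g : ℝ → ℝ} {t : ITree} (ht : t.Represents S g 1)
    (hm : t.msg = 1) (hg : ∀ x, 0 < g x) :
    ((volume.restrict (Ico 0 t.weight)).prod (volume.restrict (Ico 0 1))).map
        (fun z : ℝ × ℝ => (descend t z.1 z.2).val.2) =
      (volume.restrict (Ico t.lo t.hi)).withDensity fun x => ENNReal.ofReal (g x) := by
  induction t using descend_induction with
  | leaf lo hi w m =>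
    obtain rfl : m = 1 := hm
    obtain ⟨hlt, -, hw⟩ := ht
    have hd := sub_pos.mpr hlt
    have hw₀ : w = (hi - lo) * g lo := by simpa using hw lo ⟨le_rfl, hlt⟩
    have hf : (fun z : ℝ × ℝ => (descend (leaf lo hi w 1) z.1 z.2).val.2) =
        (fun u => lo + u * (hi - lo)) ∘ Prod.snd := by
      funext z
      rw [descend_leaf_val]
      rfl
    rw [hf, ← Measure.map_map (by fun_prop) (by fun_prop), Measure.map_snd_prod,
      Measure.map_smul, map_affine_restrict_Ico lo hd]
    have hc : (fun x => ENNReal.ofReal (g x)) =ᵐ[volume.restrict (Ico lo hi)]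
        fun _ => ENNReal.ofReal (w * (hi - lo)⁻¹) := by
      refine ae_restrict_of_forall_mem measurableSet_Ico fun x hx => ?_
      have := hw x hx
      beta_reduce
      congr 1
      field_simp
      linarith
    simp only [ITree.lo, ITree.hi, ITree.weight]
    rw [withDensity_congr_ae hc, withDensity_const, smul_smul, add_sub_cancel,
      Measure.restrict_apply_univ, Real.volume_Ico, sub_zero,
      ← ENNReal.ofReal_mul (hw₀ ▸ (mul_pos hd (hg lo)).le)]
  | node c lo hi w m l h hl hh =>
    obtain rfl : m = 1 := hm
    obtain ⟨h₁, h₂, h₃, hw, h₄, h₅⟩ := ht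
    rw [mul_one] at h₄ h₅
    have ihl := hl h₄.updated (updateMessage_msg l)
    have ihh := hh h₅.updated (updateMessage_msg h)
    have hwl := h₄.updated.effectiveWeight_pos hg
    have hwh := h₅.updated.effectiveWeight_pos hg
    rw [updateMessage_msg, mul_one, mul_one] at hwl hwh
    rw [← updateMessage_weight, ← updateMessage_weight] at hw
    rw [updateMessage_lo, updateMessage_hi, h₁, h₂] at ihl
    rw [updateMessage_lo, updateMessage_hi, h₃] at ihh
    have hlo := h₄.lo_lt_hi
    have hhi := h₅.lo_lt_hi
    simp only [ITree.lo, ITree.hi, ITree.weight]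
    generalize hwl' : (updateMessage l).val.weight = wl at *
    have hsplit : volume.restrict (Ico (0 : ℝ) w) =
        volume.restrict (Ico 0 wl) + volume.restrict (Ico wl w) := by
      rw [← Measure.restrict_union _ measurableSet_Ico,
        Ico_union_Ico_eq_Ico hwl.le (by linarith)]
      exact Ico_disjoint_Ico_same
    have hsplit' : volume.restrict (Ico lo hi) =
        volume.restrict (Ico lo h.lo) + volume.restrict (Ico h.lo hi) := by
      rw [← Measure.restrict_union _ measurableSet_Ico,
        Ico_union_Ico_eq_Ico (by linarith) (by linarith)]
      exact Ico_disjoint_Ico_same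
    rw [hsplit, hsplit', Measure.add_prod, Measure.map_add _ _ (measurable_descend _),
      withDensity_add_measure, ← ihl, ← ihh]
    congr 1
    · refine Measure.map_congr ?_
      rw [Measure.prod_restrict]
      refine ae_restrict_of_forall_mem (measurableSet_Ico.prod measurableSet_Ico) fun z hz => ?_
      beta_reduce
      rw [descend_node_val, hwl', if_pos hz.1.2]
    · have hwh' : (updateMessage h).val.weight = w - wl := by linarith
      rw [hwh', ← map_sub_restrict_Ico wl w,
        ← Measure.map_id (μ := volume.restrict (Ico (0 : ℝ) 1)),
        Measure.map_prod_map _ _ (by fun_prop) measurable_id,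
        Measure.map_map (measurable_descend _) (by fun_prop), Measure.map_id]
      refine Measure.map_congr ?_
      rw [Measure.prod_restrict]
      refine ae_restrict_of_forall_mem (measurableSet_Ico.prod measurableSet_Ico) fun z hz => ?_
      beta_reduce
      rw [descend_node_val, hwl', if_neg (not_lt.mpr hz.1.1)]
      rfl

theorem map_draw {S : Set ℝ} {η : ℝ} {F : ℝ → ℝ} {t : ITree}
    (ht : t.Represents S (fun x => Real.exp (η * F x)) 1) (hlo : t.lo = 0) (hhi : t.hi = 1) :
    seedLaw.map (fun z => (draw t z).val.2) = gibbs η F := by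
  have hu := ht.updated
  have hm := updateMessage_msg t
  have hpos := hu.effectiveWeight_pos fun x => Real.exp_pos _
  have hint := hu.integral_eq.2
  have hmap := map_descend hu hm fun x => Real.exp_pos _
  rw [hm, mul_one, mul_one] at hpos hint
  rw [updateMessage_lo, updateMessage_hi, hlo, hhi] at hint hmap
  simp only [draw_val, seedLaw, gibbs, hint]
  generalize (updateMessage t).val = s at *
  have hf : (fun z : ℝ × ℝ => (descend s (z.1 * s.weight) z.2).val.2) =
      (fun z : ℝ × ℝ => (descend s z.1 z.2).val.2) ∘ Prod.map (fun x => x * s.weight) id := rfl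
  rw [hf, ← Measure.map_map (measurable_descend s) (by fun_prop),
    ← Measure.map_prod_map _ _ (by fun_prop) measurable_id, Measure.map_id,
    map_mul_restrict_Ico hpos, Measure.prod_smul_left, Measure.map_smul, hmap,
    ← withDensity_smul' _ _ ENNReal.ofReal_ne_top]
  congr 1
  funext x
  rw [Pi.smul_apply, smul_eq_mul, ← ENNReal.ofReal_mul (inv_nonneg.mpr hpos.le), div_eq_inv_mul]

theorem represents_descend {S : Set ℝ} {g : ℝ → ℝ} {t : ITree} (ht : t.Represents S g 1)
    (hm : t.msg = 1) (x u : ℝ) :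
    (descend t x u).val.1.Represents S g 1 ∧ (descend t x u).val.1.lo = t.lo ∧
      (descend t x u).val.1.hi = t.hi ∧ (descend t x u).val.1.weight = t.weight ∧
      (descend t x u).val.1.msg = 1 := by
  induction t using descend_induction generalizing x with
  | leaf => exact descend_leaf_val _ _ _ _ x u ▸ ⟨ht, rfl, rfl, rfl, hm⟩
  | node c lo hi w m l h hl hh =>
    obtain rfl : m = 1 := hm
    obtain ⟨h₁, h₂, h₃, hw, h₄, h₅⟩ := ht
    rw [mul_one] at h₄ h₅
    rw [descend_node_val]
    split_ifs
    · obtain ⟨i₁, i₂, i₃, i₄, i₅⟩ := hl h₄.updated (updateMessage_msg l) x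
      refine ⟨⟨?_, ?_, ?_, ?_, ?_, ?_⟩, rfl, rfl, rfl, rfl⟩ <;>
        simp_all [h₅.updated]
    · obtain ⟨i₁, i₂, i₃, i₄, i₅⟩ := hh h₅.updated (updateMessage_msg h)
        (x - (updateMessage l).val.weight)
      refine ⟨⟨?_, ?_, ?_, ?_, ?_, ?_⟩, rfl, rfl, rfl, rfl⟩ <;>
        simp_all [h₄.updated]

theorem represents_draw {S : Set ℝ} {g : ℝ → ℝ} {t : ITree} (ht : t.Represents S g 1)
    (z : ℝ × ℝ) :
    (draw t z).val.1.Represents S g 1 ∧ (draw t z).val.1.lo = t.lo ∧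
      (draw t z).val.1.hi = t.hi := by
  obtain ⟨h₁, h₂, h₃, -⟩ := represents_descend ht.updated (updateMessage_msg t)
    (z.1 * (updateMessage t).val.weight) z.2
  rw [draw_val]
  exact ⟨h₁, h₂.trans (updateMessage_lo t), h₃.trans (updateMessage_hi t)⟩

/-! ### Rounds of the forecaster -/

/-- The body of the loop of `updateStep`: the update for the piece `j` of `f`. -/
noncomputable def updatePiece (η : ℝ) {k : ℕ} (f : StepFun k) (t : ITree) (j : Fin k) : Timed ITree := do
  tick 1
  let a ← op (f.a j.castSucc)
  let b ← op (f.a j.succ)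
  let nonempty ← op (decide (a < b))
  if nonempty then
    let v ← op (f.v j)
    let e ← op (η * v)
    let q ← op (Real.exp e)
    update a b q t
  else
    return t

theorem updatePiece_val (η : ℝ) {k : ℕ} (f : StepFun k) (t : ITree) (j : Fin k) :
    (updatePiece η f t j).val = if f.a j.castSucc < f.a j.succ then
      (update (f.a j.castSucc) (f.a j.succ) (Real.exp (η * f.v j)) t).val else t := by
  by_cases h : f.a j.castSucc < f.a j.succ <;> simp [updatePiece, h]

theorem updatePiece_steps_le (η : ℝ) {k : ℕ} (f : StepFun k) (t : ITree) (j : Fin k) :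
    (updatePiece η f t j).steps ≤
      7 + (update (f.a j.castSucc) (f.a j.succ) (Real.exp (η * f.v j)) t).steps := by
  by_cases h : f.a j.castSucc < f.a j.succ <;> simp [updatePiece, h] <;> omega

/-- The red-black interval trees on `[0, 1)` that represent `g`, with no messages above the root,
and have at most `n` leaves. -/
structure IsForecasterTree (g : ℝ → ℝ) (n : ℕ) (t : ITree) : Prop where
  represents : t.Represents ∅ g 1
  lo_eq : t.lo = 0
  hi_eq : t.hi = 1
  isRedBlack : ∃ b, t.IsRedBlack b
  numLeaves_le : t.numLeaves ≤ n

theorem IsForecasterTree.depth_le {g : ℝ → ℝ} {n N : ℕ} {t : ITree}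
    (ht : IsForecasterTree g n t) (hN : n ≤ N) : t.depth ≤ 2 * Nat.log 2 N + 1 := by
  obtain ⟨b, hb⟩ := ht.isRedBlack
  have h₁ := depth_le_log hb
  have h₂ : Nat.log 2 t.numLeaves ≤ Nat.log 2 N := Nat.log_mono_right (ht.numLeaves_le.trans hN)
  omega

theorem numLeaves_update_le (a b q : ℝ) (t : ITree) :
    (update a b q t).val.numLeaves ≤ t.numLeaves + 2 := by
  have h₁ := numLeaves_splitAt_le a t
  have h₂ := numLeaves_splitAt_le b (blacken (splitAt a t).val).val
  rw [numLeaves_blacken] at h₂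
  calc _ = (insertInterval a b t).val.numLeaves :=
        numLeaves_congr (skeleton_updateBetween a b q _)
    _ = (splitAt b (blacken (splitAt a t).val).val).val.numLeaves := numLeaves_blacken _
    _ ≤ _ := by omega

/-- Each of the trees met during an update is a red-black tree with at most `N` leaves, up to the
colour of its root. -/
theorem update_steps_le (a b q : ℝ) {n N : ℕ} {t : ITree} (hn : t.IsRedBlack n)
    (hN : t.numLeaves + 2 ≤ N) : (update a b q t).steps ≤ 520 * (Nat.log 2 N + 1) := by
  have hlog : ∀ {s : ITree} {m : ℕ}, s.IsRedBlack m → s.numLeaves ≤ N →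
      s.depth ≤ 2 * Nat.log 2 N + 1 := fun hs hs' => by
    have h₁ := depth_le_log hs
    have h₂ := Nat.log_mono_right (b := 2) hs'
    omega
  have l₁ := numLeaves_splitAt_le a t
  have l₂ := numLeaves_splitAt_le b (blacken (splitAt a t).val).val
  have l₃ := numLeaves_blacken (splitAt b (blacken (splitAt a t).val).val).val
  rw [numLeaves_blacken] at l₂
  obtain ⟨k, hk⟩ := isRedBlack_blacken (isRedBlack_splitAt a hn).1
  obtain ⟨m, hm⟩ := isRedBlack_blacken (isRedBlack_splitAt b hk).1
  have d₁ := hlog hn (by omega)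
  have d₂ := hlog hk (by rw [numLeaves_blacken]; omega)
  have d₃ := hlog hm (by omega)
  have s₁ := splitAt_steps_le a t
  have s₂ := splitAt_steps_le b (blacken (splitAt a t).val).val
  have s₃ := blacken_steps_le (splitAt a t).val
  have s₄ := blacken_steps_le (splitAt b (blacken (splitAt a t).val).val).val
  have s₅ := updateBetween_steps_le a b q
    (blacken (splitAt b (blacken (splitAt a t).val).val).val).val
  simp only [update, insertInterval, bind_steps, bind_val]
  omega

theorem IsForecasterTree.updatePiece {η : ℝ} {k : ℕ} {f : StepFun k} {F : ℝ → ℝ} {n : ℕ}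
    {t : ITree} (ht : IsForecasterTree (fun x => Real.exp (η * F x)) n t) (j : Fin k) :
    IsForecasterTree (fun x => Real.exp (η * (F x +
      (Ico (f.a j.castSucc) (f.a j.succ)).indicator (fun _ => f.v j) x))) (n + 2)
      (LazyTree.updatePiece η f t j).val := by
  obtain ⟨h₁, h₂, h₃, ⟨b, h₄⟩, h₅⟩ := ht
  rw [updatePiece_val]
  split_ifs with hab
  · have hlo : 0 ≤ f.a j.castSucc := f.a_zero ▸ f.mono (Fin.zero_le _)
    have hhi : f.a j.succ ≤ 1 := f.a_last ▸ f.mono (Fin.le_last _)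
    obtain ⟨i₁, i₂, i₃, i₄⟩ := represents_update (Real.exp (η * f.v j)) h₁ h₄ hab
      (h₂.trans_le hlo) (hhi.trans_eq h₃.symm)
    refine ⟨i₁.congr fun x _ => ?_, i₂.trans h₂, i₃.trans h₃, i₄,
      (numLeaves_update_le _ _ _ _).trans (by omega)⟩
    by_cases hx : x ∈ Ico (f.a j.castSucc) (f.a j.succ)
    · rw [indicator_of_mem hx, if_pos (mem_Ico.mp hx), ← Real.exp_add]
      ring_nf
    · rw [indicator_of_notMem hx, if_neg (mt mem_Ico.mpr hx), add_zero]
  · rw [Ico_eq_empty hab]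
    exact ⟨h₁.congr fun x _ => by simp, h₂, h₃, ⟨b, h₄⟩, by omega⟩

/-- A break point occurring twice, or an end point of `[0, 1)`, is not inserted again, so the bound
on the number of leaves is crude; `N` only has to dominate it throughout the loop. -/
theorem IsForecasterTree.foldlM_updatePiece {η : ℝ} {k : ℕ} {f : StepFun k} {F : ℝ → ℝ}
    {n N : ℕ} {t : ITree} (ht : IsForecasterTree (fun x => Real.exp (η * F x)) n t)
    (L : List (Fin k)) (hN : n + 2 * L.length ≤ N) :
    IsForecasterTree (fun x => Real.exp (η * (F x + (L.map fun j =>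
        (Ico (f.a j.castSucc) (f.a j.succ)).indicator (fun _ => f.v j) x).sum)))
        (n + 2 * L.length) (L.foldlM (LazyTree.updatePiece η f) t).val ∧
      (L.foldlM (LazyTree.updatePiece η f) t).steps ≤ L.length * (527 * (Nat.log 2 N + 1)) := by
  induction L generalizing F n t with
  | nil => simpa using ht
  | cons j L ih =>
    rw [List.length_cons] at hN
    obtain ⟨b, hb⟩ := ht.isRedBlack
    have hl := ht.numLeaves_le
    obtain ⟨h₁, h₂⟩ := ih (ht.updatePiece (f := f) j) (by omega)
    have h₃ := updatePiece_steps_le η f t j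
    have h₄ := update_steps_le (f.a j.castSucc) (f.a j.succ) (Real.exp (η * f.v j)) hb
      (N := N) (by omega)
    simp only [List.foldlM_cons, bind_val, bind_steps, List.map_cons, List.sum_cons,
      List.length_cons, ← add_assoc]
    refine ⟨?_, ?_⟩
    · convert h₁ using 1
      omega
    · rw [add_mul]
      omega

theorem isForecasterTree_updateStep {η : ℝ} {k : ℕ} {F : ℝ → ℝ} {n N : ℕ} {t : ITree}
    (f : StepFun k) (ht : IsForecasterTree (fun x => Real.exp (η * F x)) n t)
    (hN : n + 2 * k ≤ N) :
    IsForecasterTree (fun x => Real.exp (η * (F x + f.eval x))) (n + 2 * k)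
        (updateStep η f t).val ∧
      (updateStep η f t).steps ≤ k * (527 * (Nat.log 2 N + 1)) := by
  have h := ht.foldlM_updatePiece (f := f) (List.finRange k) (N := N) (by simpa using hN)
  simp only [List.length_finRange, ← List.ofFn_eq_map, List.sum_ofFn] at h
  exact h

theorem IsForecasterTree.draw {g : ℝ → ℝ} {n : ℕ} {t : ITree} (ht : IsForecasterTree g n t)
    (z : ℝ × ℝ) : IsForecasterTree g n (LazyTree.draw t z).val.1 := by
  obtain ⟨h₁, h₂, h₃, ⟨b, h₄⟩, h₅⟩ := ht
  obtain ⟨i₁, i₂, i₃⟩ := represents_draw h₁ z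
  exact ⟨i₁, i₂.trans h₂, i₃.trans h₃, ⟨b, (isRedBlack_congr (skeleton_draw t z) b).mpr h₄⟩,
    (numLeaves_congr (skeleton_draw t z)).trans_le h₅⟩

theorem isForecasterTree_treeAfter (η : ℝ) {k : ℕ} (f : ℕ → StepFun k) (seed : ℕ → ℝ × ℝ)
    (t : ℕ) : IsForecasterTree (fun x => Real.exp (η * cumulative f t x)) (1 + 2 * (t * k))
      (treeAfter η f seed t) := by
  induction t with
  | zero =>
    refine ⟨⟨zero_lt_one, fun p hp => hp.elim, fun x _ => ?_⟩, rfl, rfl, ⟨0, rfl⟩, Nat.le_add_right 1 _⟩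
    simp [cumulative]
  | succ t ih =>
    have h := (isForecasterTree_updateStep (f t) (ih.draw (seed t)) le_rfl).1
    have hF : ∀ x, cumulative f t x + (f t).eval x = cumulative f (t + 1) x := fun x =>
      (Finset.sum_range_succ _ t).symm
    simp only [hF] at h
    have hk : 1 + 2 * ((t + 1) * k) = 1 + 2 * (t * k) + 2 * k := by ring
    rw [hk]
    exact h

theorem natLog_le_mul_log {n : ℕ} (hn : 2 ≤ n) :
    (Nat.log 2 (1 + 2 * n) + 1 : ℝ) ≤ 8 * Real.log n := by
  have hn' : (2 : ℝ) ≤ n := by exact_mod_cast hn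
  -- as `1 + 2 * n ≤ n ^ 3` and `1 ≤ 2 * log n`, the bound follows from `3 / log 2 + 2 ≤ 8`
  have h₁ : 1 + 2 * n ≤ n ^ 3 := by nlinarith [Nat.mul_le_mul hn hn]
  have h₂ : 2 ^ Nat.log 2 (1 + 2 * n) ≤ n ^ 3 := (Nat.pow_log_le_self 2 (by omega)).trans h₁
  have h₃ : (2 : ℝ) ^ Nat.log 2 (1 + 2 * n) ≤ (n : ℝ) ^ 3 := by exact_mod_cast h₂
  have h₄ := Real.log_le_log (by positivity) h₃
  rw [Real.log_pow, Real.log_pow] at h₄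
  have h₅ := Real.log_le_log two_pos hn'
  have h₆ := Real.log_two_gt_d9
  push_cast at h₄
  nlinarith [(Nat.cast_nonneg (Nat.log 2 (1 + 2 * n)) : (0 : ℝ) ≤ _)]

end LazyTree

theorem mainTheorem4 :
    -- correctness: invariants of the tree, and exactness of the sampling step
    (∀ (k : ℕ) (η : ℝ) (f : ℕ → StepFun k) (seed : ℕ → ℝ × ℝ),
      (∀ s, seed s ∈ Set.Ico (0 : ℝ) 1 ×ˢ Set.Ico (0 : ℝ) 1) →
      ∀ t : ℕ,
        (treeAfter η f seed t).IsIntervalTree ∧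
        (treeAfter η f seed t).lo = 0 ∧
        (treeAfter η f seed t).hi = 1 ∧
        (∀ N ∈ ITree.nodes 1 (treeAfter η f seed t),
          ITree.omega N = ((ITree.leavesBelow N).map ITree.omega).sum) ∧
        (∀ N ∈ ITree.nodes 1 (treeAfter η f seed t), N.2.isLeaf →
          ∀ x ∈ Set.Ico N.2.lo N.2.hi,
            ITree.omega N = (N.2.hi - N.2.lo) * Real.exp (η * cumulative f t x)) ∧
        MeasureTheory.Measure.map
            (fun z : ℝ × ℝ => (draw (treeAfter η f seed t) z).val.2) seedLaw =
          gibbs η (cumulative f t)) ∧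
    -- running time of the sampling step and of the update step in rounds `1, …, T`
    ∃ C : ℝ, ∀ T k : ℕ, 2 ≤ T * k →
      ∀ (η : ℝ) (f : ℕ → StepFun k) (seed : ℕ → ℝ × ℝ),
      (∀ s, seed s ∈ Set.Ico (0 : ℝ) 1 ×ˢ Set.Ico (0 : ℝ) 1) →
      ∀ t < T,
        ((draw (treeAfter η f seed t) (seed t)).steps : ℝ) ≤ C * Real.log (T * k) ∧
        ((updateStep η (f t) (draw (treeAfter η f seed t) (seed t)).val.1).steps : ℝ) ≤
          C * (k * Real.log (T * k)) := by
  refine ⟨fun k η f seed _ t => ?_, 527 * 8, fun T k hTk η f seed _ t ht => ?_⟩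
  · have h := isForecasterTree_treeAfter η f seed t
    refine ⟨h.represents.isIntervalTree, h.lo_eq, h.hi_eq,
      fun N hN => (h.represents.of_mem_nodes hN).omega_eq_sum, fun N hN hleaf x hx => ?_,
      map_draw h.represents h.lo_eq h.hi_eq⟩
    have hr := h.represents.of_mem_nodes hN
    obtain ⟨c, s⟩ := N
    cases s with
    | leaf lo hi w m => exact hr.2.2 x hx
    | node => simp [ITree.isLeaf] at hleaf
  -- with `D = log₂ (1 + 2Tk) + 1`, a draw takes at most `527 D` steps, an update step `527 k D`
  · have h := isForecasterTree_treeAfter η f seed t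
    have hlog := natLog_le_mul_log hTk
    push_cast at hlog
    have hle : 1 + 2 * (t * k) + 2 * k ≤ 1 + 2 * (T * k) := by
      have := Nat.mul_le_mul_right k (Nat.succ_le_of_lt ht)
      rw [Nat.succ_mul] at this
      omega
    have hd : (draw (treeAfter η f seed t) (seed t)).steps ≤
        527 * (Nat.log 2 (1 + 2 * (T * k)) + 1) := by
      have h₁ := draw_steps_le (treeAfter η f seed t) (seed t)
      have h₂ := h.depth_le (N := 1 + 2 * (T * k)) (by omega)
      omega
    have hu := (isForecasterTree_updateStep (f t) (h.draw (seed t)) hle).2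
    have hd' : ((draw (treeAfter η f seed t) (seed t)).steps : ℝ) ≤
        527 * (Nat.log 2 (1 + 2 * (T * k)) + 1) := by exact_mod_cast hd
    have hu' : ((updateStep η (f t) (draw (treeAfter η f seed t) (seed t)).val.1).steps : ℝ) ≤
        k * (527 * (Nat.log 2 (1 + 2 * (T * k)) + 1)) := by exact_mod_cast hu
    refine ⟨by linarith, hu'.trans ?_⟩
    have := mul_le_mul_of_nonneg_left hlog (Nat.cast_nonneg (α := ℝ) k)
    linarith
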